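/- **Conventions.** For a polytope $P=\mathrm{conv}\{v_1,\dots,v_n\}$ described inside its affine hull by inequalities $a_i^\intercal x\le b_i$ ($i\in[m]$), the matrix $S_{ij}=b_i-a_i^\intercal v_j$ is called a slack matrix of $P$ (linear equations valid on $P$ contribute no rows). Equality of matrices is understood up to permuting rows and columns. If $S_1,S_2$ are matrices with special rows $x_1,y_1$ that have entries in $\{0,1\}$ and contain both values, the 2-product $(S_1,x_1)\otimes_2(S_2,y_1)$ has one column for each pair (column $c_1$ of $S_1$, column $c_2$ of $S_2$) such that $x_1$ at $c_1$ equals $y_1$ at $c_2$; this column consists of $c_1$ without its special entry, $c_2$ without its special entry, and the common special entry. $S+(\mathbf 1-x)$ is $S$ with the additional row $\mathbf 1-x$. For $2\le k\le d-2$, $S_{d,k}$ is the matrix with columns $(v,\mathbf 1-v)$, where $v$ runs over the vectors in $\{0,1\}^d$ with exactly $k$ ones; its rows are those of the inequalities $x_q\ge 0$ and $x_q\le 1$. For $k=1$ (rows $x_q\ge0$) and for $k=d-1\geq 2$ (rows $x_q\le 1$), $S_{d,k}$ is the identity matrix $I_d$. $B(M)\subseteq\mathbb R^E$ is the convex hull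 of the characteristic vectors of the bases of a matroid $M$ on a finite set $E$. $M$ is connected if it is not a direct sum of two matroids with non-empty ground sets. $U_{d,k}$ is the uniform matroid of rank $k$ on $d$ elements. If $E(M_1)\cap E(M_2)=\{p\}$, where $p$ is neither a loop nor a coloop of $M_1$ or $M_2$, then $M_1\oplus_2M_2$ is the matroid on $(E(M_1)\cup E(M_2))\setminus\{p\}$ with bases $(B_1\cup B_2)\setminus\{p\}$, where $B_i$ is a basis of $M_i$ and $p\in B_1\triangle B_2$. **Lemma.** Let $M$ be a connected matroid on a finite set $E$, and let $S$ be a 0/1 slack matrix of $B(M)$ that contains the row of each inequality $x_e\ge 0$, $e\in E$. Suppose $S=(S_1,x_1)\otimes_2(S_2,\overline y_1)$ for some matrices $S_1,S_2$ with special rows $x_1,\overline y_1$ as above. Let $S_1'=S_1+(\mathbf 1-x_1)$ and $S_2'=S_2+(\mathbf 1-\overline y_1)$, and suppose that $S_1$ or $S_1'$ equals $S_{d,k}$ for some $d>k\ge 1$. Then there are $k'\in\{k,d-k\}$ and a matroid $M_2$ such that $$M=U_{d,k'}\oplus_2 M_2$$ and $S_2'$ is a slack matrix of $B(M_2)$.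 Moreover, $k'=k$ if, under the identification of $S_1$ or $S_1'$ with $S_{d,k}$, some row of $S_1$ other than $x_1$ that gives in $S$ the row of an inequality $x_e\ge0$ ($e\in E$) is the row of an inequality $x_q\ge 0$ of $S_{d,k}$. -/

import Mathlib

namespace MatroidSlack

/-! ### Slack matrices -/

/-- `S` is the slack matrix of the polytope `P` associated to the points `v j` (whose convex hull is
`P`) and to some system of linear inequalities `a i x ≤ b i` which, inside the affine hull of `P`,
describes `P`.  Linear equations valid on `P` do not contribute rows. -/
def IsSlackMatrixAt {V R C : Type*} [AddCommGroup V] [Module ℝ V]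
    (S : Matrix R C ℝ) (P : Set V) (v : C → V) : Prop :=
  P = convexHull ℝ (Set.range v) ∧
    ∃ (a : R → (V →ₗ[ℝ] ℝ)) (b : R → ℝ),
      P = {x | x ∈ affineSpan ℝ P ∧ ∀ i, a i x ≤ b i} ∧
        ∀ i j, S i j = b i - a i (v j)

/-- `S` is a slack matrix of the polytope `P`. -/
def IsSlackMatrix {V R C : Type*} [AddCommGroup V] [Module ℝ V]
    (S : Matrix R C ℝ) (P : Set V) : Prop :=
  ∃ v : C → V, IsSlackMatrixAt S P v

/-- The base polytope `B(M) ⊆ ℝ^E`: the convex hull of the characteristic vectors of the bases. -/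
noncomputable def basePolytope {α : Type*} (M : Matroid α) : Set (M.E → ℝ) :=
  convexHull ℝ {x | ∃ B, M.IsBase B ∧ x = fun e : M.E => B.indicator (fun _ => (1 : ℝ)) (e : α)}

/-! ### The 2-product of matrices -/

/-- The row `x` of `S` may serve as special row: its entries are 0 or 1 and both values occur. -/
def IsSpecialRow {R C : Type*} (S : Matrix R C ℝ) (x : R) : Prop :=
  (∀ c, S x c = 0 ∨ S x c = 1) ∧ (∃ c, S x c = 0) ∧ (∃ c, S x c = 1)

/-- Row indices of the 2-product: the non-special rows of the first factor, those of the second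
factor, and one special row. -/
abbrev TwoProductRow {R₁ R₂ : Type*} (x : R₁) (y : R₂) : Type _ :=
  {i : R₁ // i ≠ x} ⊕ ({i : R₂ // i ≠ y} ⊕ Unit)

/-- Column indices of the 2-product: pairs of columns that agree in the special rows. For special
rows with 0/1 entries these are the columns of the two blocks
`S₁⁰ ⊗ S₂⁰` and `S₁¹ ⊗ S₂¹`. -/
abbrev TwoProductCol {R₁ C₁ R₂ C₂ : Type*} (S₁ : Matrix R₁ C₁ ℝ) (x : R₁)
    (S₂ : Matrix R₂ C₂ ℝ) (y : R₂) : Type _ :=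
  {c : C₁ × C₂ // S₁ x c.1 = S₂ y c.2}

/-- The 2-product `(S₁, x) ⊗₂ (S₂, y)`. -/
def twoProduct {R₁ C₁ R₂ C₂ : Type*} (S₁ : Matrix R₁ C₁ ℝ) (x : R₁)
    (S₂ : Matrix R₂ C₂ ℝ) (y : R₂) :
    Matrix (TwoProductRow x y) (TwoProductCol S₁ x S₂ y) ℝ :=
  fun r c =>
    match r with
    | Sum.inl i => S₁ i.1 c.1.1
    | Sum.inr (Sum.inl i) => S₂ i.1 c.1.2
    | Sum.inr (Sum.inr _) => S₁ x c.1.1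

/-- `S + (1 - x)`: the matrix `S` with the complement of its row `x` as an additional row. -/
def addComplement {R C : Type*} (S : Matrix R C ℝ) (x : R) : Matrix (Option R) C ℝ :=
  fun r c =>
    match r with
    | none => 1 - S x c
    | some i => S i c

/-! ### The hypersimplex slack matrix -/

/-- Row indices of `S_{d,k}`: `(q, true)` is the inequality `x_q ≥ 0` and `(q, false)` is the
inequality `x_q ≤ 1`.  For `2 ≤ k ≤ d - 2` all of them are present; for `k = 1` only the
inequalities `x_q ≥ 0` and for `k = d - 1 ≥ 2` only the inequalities `x_q ≤ 1` are, so that in both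
of these cases `S_{d,k}` is an identity matrix. -/
abbrev HypersimplexRow (d k : ℕ) : Type :=
  {r : Fin d × Bool // (k = 1 → r.2 = true) ∧ (k ≠ 1 → k + 1 = d → r.2 = false)}

/-- Column indices of `S_{d,k}`: the `k`-element subsets of a `d`-element set. -/
abbrev HypersimplexCol (d k : ℕ) : Type :=
  {s : Finset (Fin d) // s.card = k}

/-- The irredundant 0/1 slack matrix `S_{d,k}` of the base polytope of `U_{d,k}`. -/
def hypersimplexSlack (d k : ℕ) : Matrix (HypersimplexRow d k) (HypersimplexCol d k) ℝ :=
  fun r s =>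
    if r.1.2 = true then (if r.1.1 ∈ s.1 then 1 else 0) else (if r.1.1 ∈ s.1 then 0 else 1)

/-- `S` or `S + (1 - x)` is equal to `S_{d,k}` up to permuting rows and columns, in such a way that
the row `i` of `S` is the row `σ i` of `S_{d,k}`. -/
def EqHypersimplexSlack {R C : Type*} (S : Matrix R C ℝ) (x : R) (d k : ℕ)
    (σ : R → Fin d × Bool) : Prop :=
  ∃ τ : C ≃ HypersimplexCol d k,
    (∃ f : R ≃ HypersimplexRow d k,
      S = (hypersimplexSlack d k).submatrix f τ ∧ ∀ i, (f i).1 = σ i) ∨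
    (∃ f : Option R ≃ HypersimplexRow d k,
      addComplement S x = (hypersimplexSlack d k).submatrix f τ ∧ ∀ i, (f (some i)).1 = σ i)

/-! ### Matroids -/

/-- `M` cannot be written as the 1-sum of two matroids with non-empty ground sets. -/
def IsConnected {α : Type*} (M : Matroid α) : Prop :=
  ¬ ∃ (M₁ M₂ : Matroid α) (h : Disjoint M₁.E M₂.E),
    M₁.E.Nonempty ∧ M₂.E.Nonempty ∧ M = M₁.disjointSum M₂ h

/-- `M` is the uniform matroid `U_{d,k}` on its ground set. -/
def IsUniform {α : Type*} (M : Matroid α) (d k : ℕ) : Prop :=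
  M.E.encard = d ∧ ∀ B, M.IsBase B ↔ B ⊆ M.E ∧ B.encard = k

/-- `M = M₁ ⊕₂ M₂`, the 2-sum along the common element `p`. -/
def IsTwoSum {α : Type*} (M M₁ M₂ : Matroid α) (p : α) : Prop :=
  M₁.E ∩ M₂.E = {p} ∧
  ¬ M₁.IsLoop p ∧ ¬ M₁.IsColoop p ∧ ¬ M₂.IsLoop p ∧ ¬ M₂.IsColoop p ∧
  M.E = (M₁.E ∪ M₂.E) \ {p} ∧
  ∀ B, M.IsBase B ↔ ∃ B₁ B₂, M₁.IsBase B₁ ∧ M₂.IsBase B₂ ∧ p ∈ symmDiff B₁ B₂ ∧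
    B = (B₁ ∪ B₂) \ {p}

end MatroidSlack

namespace MatroidSlack

/-! ### Connected matroids -/

/-! The rows `x_e ≥ 0` make the points of the slack presentation 0/1 vectors, so they are exactly
the bases of `M`. Columns of a 2-product are compatible pairs, so each base is some `𝓑 c₁ c₂`, where
`c₁` is a `k`-set in `[d]` whose bit at a distinguished coordinate `q₀` (that of the special row) is
tied to `c₂`. Membership of an element is read off its own row: it is a signed coordinate `q ≠ q₀`
of the `k`-set, or it depends on `c₂` alone. `GluedBases` records this.

The core is combinatorial and needs `d ≥ 3`. Swapping two coordinates other than `q₀` in the `k`-set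
leaves `c₂` admissible, so comparing the two bases forces elements over all `q ≠ q₀` with one common
sign (`exists_sign`). Connectedness and base exchange exclude the opposite sign, even over `q₀`
(`not_complement`). If the common sign is negative, the hypersimplex is complemented, which turns
`k` into `d - k`; this is the only source of the ambiguity in `k'`.

Now every base glues a `k'`-set to a member of a family `𝓗` along `q₀`. Fix a `(k' - 1)`-set `X`
avoiding `q₀` and another coordinate `q₁`. The bases that meet the coordinate elements in `X` or `X
∪ {q₁}` are copies of the members of `𝓗`, the element over `q₁` playing `p`. Hence `𝓗` inherits base
exchange from `M` and is the set of bases of a matroid `M₂`, which gives the 2-sum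
(`exists_isTwoSum`).

These bases also span a coordinate face of `B(M)`, which is `B(M₂)`. On its columns a row of `S₁`
becomes constant, equal to the special row, or its complement, so `S₂` with the complement row
describes the face (`IsSlackMatrixAt.face`, `isSlackMatrix_addComplement`). For `d = 2` the 2-sum
with `U_{2,1}` only renames an element, and the face is all of `B(M)`. -/

lemma isBasis_inter_of_ncard_eq {α : Type*} {M : Matroid α} [M.Finite] {A : Set α} (hA : A ⊆ M.E)
    {n : ℕ} (h : ∀ B, M.IsBase B → (B ∩ A).ncard = n) {B : Set α} (hB : M.IsBase B) :
    M.IsBasis (B ∩ A) A := by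
  obtain ⟨I, hI, hBI⟩ := (hB.indep.inter_right A).subset_isBasis_of_subset Set.inter_subset_right hA
  obtain ⟨B', hB', hIB'⟩ := hI.indep.exists_isBase_superset
  have hfin : (B' ∩ A).Finite := hB'.finite.subset Set.inter_subset_left
  have h1 : I ⊆ B' ∩ A := Set.subset_inter hIB' hI.subset
  have h2 : B ∩ A = B' ∩ A :=
    Set.eq_of_subset_of_ncard_le (hBI.trans h1) (by rw [h B hB, h B' hB']) hfin
  have : I = B ∩ A := (h1.trans h2.symm.subset).antisymm hBI
  rwa [← this]

lemma ncard_eq_of_isBasis {α : Type*} {M : Matroid α} {A I : Set α}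
    {n : ℕ} (h : ∀ B, M.IsBase B → (B ∩ A).ncard = n) (hI : M.IsBasis I A) : I.ncard = n := by
  obtain ⟨B, hB, rfl⟩ := hI.exists_isBase
  exact h B hB

/-- A connected matroid has no proper separator. -/
lemma IsConnected.ground_subset {α : Type*} {M : Matroid α} [M.Finite] (hM : IsConnected M)
    {A : Set α} (hA : A ⊆ M.E) (hne : A.Nonempty) {n : ℕ}
    (h : ∀ B, M.IsBase B → (B ∩ A).ncard = n) : M.E ⊆ A := by
  by_contra hcon
  obtain ⟨e, heE, heA⟩ := Set.not_subset.1 hcon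
  obtain ⟨B₀, hB₀⟩ := M.exists_isBase
  have h' : ∀ B, M.IsBase B → (B ∩ (M.E \ A)).ncard = B₀.ncard - n := by
    intro B hB
    have h1 : B ∩ (M.E \ A) = B \ A := by
      rw [← Set.inter_sdiff_assoc, Set.inter_eq_self_of_subset_left hB.subset_ground]
    have h2 := Set.ncard_inter_add_ncard_sdiff_eq_ncard B A hB.finite
    rw [h1, hB₀.ncard_eq_ncard_of_isBase hB, ← h2, h B hB]
    omega
  have hA' : M.E \ A ⊆ M.E := Set.sdiff_subset
  have hdisj : Disjoint (M.restrict A).E (M.restrict (M.E \ A)).E := by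
    simpa using Set.disjoint_sdiff_right
  refine hM ⟨M.restrict A, M.restrict (M.E \ A), hdisj, hne, ⟨e, heE, heA⟩, ?_⟩
  refine Matroid.ext_isBase (by simpa using (Set.union_eq_self_of_subset_left hA).symm) fun B hBE => ?_
  rw [Matroid.disjointSum_isBase_iff, Matroid.restrict_ground_eq, Matroid.restrict_ground_eq,
    Matroid.isBase_restrict_iff hA, Matroid.isBase_restrict_iff hA']
  constructor
  · intro hB
    exact ⟨isBasis_inter_of_ncard_eq hA h hB, isBasis_inter_of_ncard_eq hA' h' hB,
      hB.subset_ground.trans (by simp)⟩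
  · rintro ⟨h1, h2, -⟩
    have hun : B ∩ A ∪ B ∩ (M.E \ A) = B := by
      rw [← Set.inter_union_distrib_left, Set.union_sdiff_cancel hA,
        Set.inter_eq_self_of_subset_left hBE]
    -- `B` contains a basis of each part, so it spans. A base inside it meets each part in the
    -- prescribed number of elements, hence is all of `B`.
    have hspan : M.Spanning B := by
      rw [Matroid.spanning_iff_ground_subset_closure]
      intro f hf
      by_cases hfA : f ∈ A
      · exact M.closure_subset_closure Set.inter_subset_left (h1.subset_closure hfA)
      · exact M.closure_subset_closure Set.inter_subset_left (h2.subset_closure ⟨hf, hfA⟩)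
    obtain ⟨B', hB', hBB'⟩ := hspan.exists_isBase_subset
    have hfinB : B.Finite := M.ground_finite.subset hBE
    have e1 : B' ∩ A = B ∩ A := Set.eq_of_subset_of_ncard_le (Set.inter_subset_inter_left A hBB')
      (by rw [h B' hB', ncard_eq_of_isBasis h h1]) (hfinB.subset Set.inter_subset_left)
    have e2 : B' ∩ (M.E \ A) = B ∩ (M.E \ A) :=
      Set.eq_of_subset_of_ncard_le (Set.inter_subset_inter_left _ hBB')
        (by rw [h' B' hB', ncard_eq_of_isBasis h' h2]) (hfinB.subset Set.inter_subset_left)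
    have : B' = B := by
      rw [← hun, ← e1, ← e2, ← Set.inter_union_distrib_left, Set.union_sdiff_cancel hA,
        Set.inter_eq_self_of_subset_left hB'.subset_ground]
    rwa [← this]

/-- An element that is in some, but not in all bases does not lie in the same bases as another
element. -/
lemma not_forall_mem_isBase_iff {α : Type*} {M : Matroid α} {e f : α} (hef : e ≠ f)
    (h1 : ∃ B, M.IsBase B ∧ e ∈ B) (h0 : ∃ B, M.IsBase B ∧ e ∉ B) :
    ¬ ∀ B, M.IsBase B → (e ∈ B ↔ f ∈ B) := by
  intro h
  obtain ⟨B, hB, heB⟩ := h1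
  obtain ⟨B', hB', heB'⟩ := h0
  obtain ⟨g, hg, hBg⟩ := hB.exchange hB' ⟨heB, heB'⟩
  have hf : f ∈ B := (h B hB).1 heB
  -- The exchanged base loses `e` but keeps `f`.
  have : e ∈ insert g (B \ {e}) := (h _ hBg).2 (Set.mem_insert_of_mem _ ⟨hf, hef.symm⟩)
  rcases this with rfl | h3
  · exact hg.2 heB
  · exact h3.2 rfl

lemma IsConnected.exists_mem_isBase {α : Type*} {M : Matroid α} [M.Finite] (hM : IsConnected M)
    {e f : α} (he : e ∈ M.E) (hf : f ∈ M.E) (hef : e ≠ f) : ∃ B, M.IsBase B ∧ e ∈ B := by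
  by_contra! h
  have := hM.ground_subset (A := {e}) (by simpa using he) (by simp) (n := 0) (fun B hB => by
    rw [Set.inter_singleton_eq_empty.2 (h B hB), Set.ncard_empty]) hf
  exact hef this.symm

lemma IsConnected.exists_notMem_isBase {α : Type*} {M : Matroid α} [M.Finite] (hM : IsConnected M)
    {e f : α} (he : e ∈ M.E) (hf : f ∈ M.E) (hef : e ≠ f) : ∃ B, M.IsBase B ∧ e ∉ B := by
  by_contra! h
  have := hM.ground_subset (A := {e}) (by simpa using he) (by simp) (n := 1) (fun B hB => by
    rw [Set.inter_singleton_of_mem (h B hB), Set.ncard_singleton]) hf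
  exact hef this.symm

/-- Distinct elements of a connected matroid do not lie in the same bases. -/
lemma IsConnected.not_forall_mem_isBase_iff {α : Type*} {M : Matroid α} [M.Finite]
    (hM : IsConnected M) {e f : α} (he : e ∈ M.E) (hf : f ∈ M.E) (hef : e ≠ f) :
    ¬ ∀ B, M.IsBase B → (e ∈ B ↔ f ∈ B) :=
  MatroidSlack.not_forall_mem_isBase_iff hef (hM.exists_mem_isBase he hf hef)
    (hM.exists_notMem_isBase he hf hef)

/-- Every base meets the pair in exactly one element, so the pair is a separator. -/
lemma IsConnected.ground_subset_pair {α : Type*} {M : Matroid α} [M.Finite]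
    (hM : IsConnected M) {e f : α} (he : e ∈ M.E) (hf : f ∈ M.E)
    (h : ∀ B, M.IsBase B → (e ∈ B ↔ f ∉ B)) : M.E ⊆ {e, f} := by
  refine hM.ground_subset (n := 1) (by rintro a (rfl | rfl) <;> assumption) (by simp)
    fun B hB => ?_
  rw [Set.ncard_eq_one]
  by_cases hfB : f ∈ B
  · have heB : e ∉ B := fun h' => (h B hB).1 h' hfB
    exact ⟨f, by ext a; constructor
                 · rintro ⟨h1, rfl | rfl⟩
                   · exact absurd h1 heB
                   · rfl
                 · rintro rfl; exact ⟨hfB, by simp⟩⟩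
  · have heB : e ∈ B := (h B hB).2 hfB
    exact ⟨e, by ext a; constructor
                 · rintro ⟨h1, rfl | rfl⟩
                   · rfl
                   · exact absurd h1 hfB
                 · rintro rfl; exact ⟨heB, by simp⟩⟩

/-! ### Hypersimplices -/

/-- `X ∪ {q}` and `X ∪ {r}` are the ends of an edge of the hypersimplex. Such an edge later singles
out the face that carries `M₂`. -/
lemma exists_finset_pair_compl {d k : ℕ} (hk : 1 ≤ k) (hkd : k < d) {q r : Fin d} (hqr : q ≠ r) :
    ∃ X : Finset (Fin d), q ∉ X ∧ r ∉ X ∧ X.card + 1 = k := by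
  have h : k - 1 ≤ (Finset.univ \ {q, r} : Finset (Fin d)).card := by
    rw [Finset.card_sdiff_of_subset (Finset.subset_univ _), Finset.card_pair hqr, Finset.card_univ,
      Fintype.card_fin]
    omega
  obtain ⟨X, hX, hcard⟩ := Finset.exists_subset_card_eq h
  refine ⟨X, fun hq => ?_, fun hr => ?_, by omega⟩
  · have := hX hq; simp at this
  · have := hX hr; simp at this

/-- Two `k`-sets that differ only in `q` and `r`. -/
lemma exists_finset_swap {d k : ℕ} (hk : 1 ≤ k) (hkd : k < d) {q r : Fin d} (hqr : q ≠ r) :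
    ∃ T T' : Finset (Fin d), T.card = k ∧ T'.card = k ∧ q ∈ T ∧ r ∉ T ∧ q ∉ T' ∧ r ∈ T' ∧
      ∀ a, a ≠ q → a ≠ r → (a ∈ T ↔ a ∈ T') := by
  obtain ⟨X, hq, hr, hX⟩ := exists_finset_pair_compl hk hkd hqr
  refine ⟨insert q X, insert r X, by rw [Finset.card_insert_of_notMem hq, hX],
    by rw [Finset.card_insert_of_notMem hr, hX], by simp, by simp [hr, hqr.symm],
    by simp [hq, hqr], by simp, fun a h1 h2 => by simp [h1, h2]⟩

/-! ### Faces of 0/1 polytopes -/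

/-- A 0/1 point is extreme in the unit cube, hence in any convex subset of the cube that contains
it. -/
lemma mem_of_mem_convexHull_of_zero_one {ι : Type*} {s : Set (ι → ℝ)}
    (hs : ∀ y ∈ s, ∀ e, y e = 0 ∨ y e = 1) {x : ι → ℝ} (hx : ∀ e, x e = 0 ∨ x e = 1)
    (hxs : x ∈ convexHull ℝ s) : x ∈ s := by
  have hsub : convexHull ℝ s ⊆ Set.pi Set.univ fun _ : ι => Set.Icc (0 : ℝ) 1 := by
    refine convexHull_min (fun y hy e _ => ?_) (convex_pi fun _ _ => convex_Icc 0 1)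
    rcases hs y hy e with h | h <;> simp [h]
  refine extremePoints_convexHull_subset (𝕜 := ℝ)
    (inter_extremePoints_subset_extremePoints_of_subset hsub ⟨hxs, ?_⟩)
  rw [extremePoints_pi]
  intro e _
  rw [Set.extremePoints_Icc zero_le_one]
  simpa using hx e

/-- A point of the hull of a set of 0/1 points that lies on a coordinate face of the cube is in the
hull of the points on that face. -/
lemma mem_convexHull_face {ι : Type*} {s : Set (ι → ℝ)}
    (hs : ∀ y ∈ s, ∀ e, y e = 0 ∨ y e = 1) (D : Set ι) {t : ι → ℝ}
    (ht : ∀ e ∈ D, t e = 0 ∨ t e = 1) {x : ι → ℝ}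
    (hxs : x ∈ convexHull ℝ s) (hx : ∀ e ∈ D, x e = t e) :
    x ∈ convexHull ℝ {y ∈ s | ∀ e ∈ D, y e = t e} := by
  set F := {y ∈ s | ∀ e ∈ D, y e = t e}
  -- The set on the right is convex: `t` is extremal in each coordinate of `D`, so a proper convex
  -- combination involving a point off the face stays off the face.
  have key : convexHull ℝ s ⊆ {x | (∀ e, 0 ≤ x e ∧ x e ≤ 1) ∧
      ((∃ e ∈ D, x e ≠ t e) ∨ x ∈ convexHull ℝ F)} := by
    refine convexHull_min (fun y hy => ⟨fun e => ?_, ?_⟩) ?_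
    · rcases hs y hy e with h | h <;> simp [h]
    · by_cases h : ∃ e ∈ D, y e ≠ t e
      · exact Or.inl h
      · push Not at h
        exact Or.inr (subset_convexHull ℝ _ ⟨hy, h⟩)
    · rw [convex_iff_forall_pos]
      rintro y ⟨hy1, hy2⟩ z ⟨hz1, hz2⟩ a b ha hb hab
      have haux : ∀ {y z : ι → ℝ} {a b : ℝ}, (∀ e, 0 ≤ y e ∧ y e ≤ 1) → (∀ e, 0 ≤ z e ∧ z e ≤ 1) →
          0 < a → 0 < b → a + b = 1 → (∃ e ∈ D, y e ≠ t e) →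
          ∃ e ∈ D, (a • y + b • z) e ≠ t e := by
        rintro y z a b hy hz ha hb hab ⟨e, he, hne⟩
        refine ⟨e, he, fun h => hne ?_⟩
        have h' : a * y e + b * z e = t e := h
        have hz := hz e
        have hy := hy e
        rcases ht e he with h0 | h0 <;> rw [h0] at h' ⊢
        · have h1 : 0 ≤ b * z e := mul_nonneg hb.le hz.1
          have h2 : a * y e ≤ 0 := by linarith
          exact le_antisymm (nonpos_of_mul_nonpos_right h2 ha) hy.1
        · have h1 : b * z e ≤ b := mul_le_of_le_one_right hb.le hz.2
          have h2 : a ≤ a * y e := by linarith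
          exact le_antisymm hy.2 ((le_mul_iff_one_le_right ha).1 h2)
      refine ⟨fun e => ?_, ?_⟩
      · have hz := hz1 e
        have hy := hy1 e
        change 0 ≤ a * y e + b * z e ∧ a * y e + b * z e ≤ 1
        constructor
        · have := mul_nonneg ha.le hy.1
          have := mul_nonneg hb.le hz.1
          linarith
        · have := mul_le_of_le_one_right ha.le hy.2
          have := mul_le_of_le_one_right hb.le hz.2
          linarith
      · rcases hy2 with hy2 | hy2
        · exact Or.inl (haux hy1 hz1 ha hb hab hy2)
        rcases hz2 with hz2 | hz2
        · rw [add_comm (a • y)]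
          exact Or.inl (haux hz1 hy1 hb ha (by linarith) hz2)
        · exact Or.inr (convex_convexHull ℝ F hy2 hz2 ha.le hb.le hab)
  rcases (key hxs).2 with ⟨e, he, hne⟩ | h
  · exact absurd (hx e he) hne
  · exact h

/-- The affine embedding `u ↦ (u, t)` of a coordinate subspace. -/
noncomputable def faceEmbedding {ι ι' : Type*} (g : ι' → ι) (t : ι → ℝ) :
    (ι' → ℝ) →ᵃ[ℝ] (ι → ℝ) where
  toFun u := Function.extend g u t
  linear :=
    { toFun := fun u => Function.extend g u 0
      map_add' := fun u w => by
        rw [← Function.extend_add, add_zero]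
      map_smul' := fun c u => by
        have := Function.extend_smul c g u 0
        simpa using this }
  map_vadd' u w := by
    have := Function.extend_add g w u (0 : ι → ℝ) t
    simpa using this

lemma faceEmbedding_apply {ι ι' : Type*} (g : ι' → ι) (t : ι → ℝ) (u : ι' → ℝ) :
    faceEmbedding g t u = Function.extend g u t := rfl

/-- A matrix whose rows are nonnegative affine functions and that contains, up to constant rows,
every row of `S` restricted to a coordinate face is a slack matrix of that face. -/
lemma IsSlackMatrixAt.face {ι ι' R C R' C' : Type*} {S : Matrix R C ℝ} {P : Set (ι → ℝ)}
    {v : C → ι → ℝ} (hS : IsSlackMatrixAt S P v) (hv : ∀ j e, v j e = 0 ∨ v j e = 1)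
    {S' : Matrix R' C' ℝ} (hS' : ∀ i j, 0 ≤ S' i j)
    (g : ι' → ι) (hg : Function.Injective g) (t : ι → ℝ)
    (ht : ∀ e ∉ Set.range g, t e = 0 ∨ t e = 1) (lift : C' → C)
    (hlift : ∀ c, ∀ e ∉ Set.range g, v (lift c) e = t e)
    (hsurj : ∀ j, (∀ e ∉ Set.range g, v j e = t e) → ∃ c, v j = v (lift c))
    (hrow : ∀ i', ∃ i, (∀ c, S' i' c = S i (lift c)) ∨ (∀ c, S' i' c = 1 - S i (lift c)))
    (hrow' : ∀ i, (∃ i', ∀ c, S i (lift c) = S' i' c) ∨ ∃ s, 0 ≤ s ∧ ∀ c, S i (lift c) = s) :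
    IsSlackMatrixAt S' (convexHull ℝ (Set.range fun c => v (lift c) ∘ g))
      (fun c => v (lift c) ∘ g) := by
  obtain ⟨hP, a, b, hPab, hSab⟩ := hS
  set w : C' → ι' → ℝ := fun c => v (lift c) ∘ g with hw
  set L := faceEmbedding g t with hL
  have hLg : ∀ u m, L u (g m) = u m := fun u m => by
    rw [hL, faceEmbedding_apply, hg.extend_apply]
  have hLt : ∀ u, ∀ e ∉ Set.range g, L u e = t e := fun u e he => by
    rw [hL, faceEmbedding_apply, Function.extend_apply' _ _ _ (by simpa using he)]
  have hLw : ∀ c, L (w c) = v (lift c) := by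
    intro c
    ext e
    by_cases he : e ∈ Set.range g
    · obtain ⟨m, rfl⟩ := he
      rw [hLg]; rfl
    · rw [hLt _ _ he, hlift c e he]
  -- rows of `S` as affine functions on the small space
  let A : R → (ι' → ℝ) →ᵃ[ℝ] ℝ := fun i =>
    AffineMap.const ℝ (ι' → ℝ) (b i) - (a i).toAffineMap.comp L
  have hA : ∀ i u, A i u = b i - a i (L u) := fun i u => rfl
  have hAw : ∀ i c, A i (w c) = S i (lift c) := fun i c => by rw [hA, hLw, hSab]
  have hA' : ∀ i', ∃ A' : (ι' → ℝ) →ᵃ[ℝ] ℝ, ∀ c, S' i' c = A' (w c) := by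
    intro i'
    obtain ⟨i, h | h⟩ := hrow i'
    · exact ⟨A i, fun c => by rw [hAw, h]⟩
    -- A complemented row is still the restriction of an affine function, although `S` need not have
    -- it as a row.
    · exact ⟨AffineMap.const ℝ (ι' → ℝ) 1 - A i, fun c => by
        rw [h, ← hAw]; rfl⟩
  choose A' hA' using hA'
  have hdec : ∀ i' u, A' i' u = A' i' 0 - (-(A' i').linear) u := fun i' u => by
    have := congrFun (A' i').decomp u
    simp only [Pi.add_apply] at this
    rw [this]
    simp [add_comm]
  -- Agreement on the points determines an affine function only on their affine hull, which is where
  -- inequalities of the slack description are compared.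
  have hlinW : ∀ {f f' : (ι' → ℝ) →ᵃ[ℝ] ℝ}, (∀ c, f (w c) = f' (w c)) →
      ∀ u ∈ affineSpan ℝ (Set.range w), f u = f' u := by
    intro f f' h u hu
    have : Set.EqOn f f' (affineSpan ℝ (Set.range w)) :=
      AffineMap.eqOn_affineSpan (k := ℝ) (by rintro _ ⟨c, rfl⟩; exact h c)
    exact this hu
  refine ⟨rfl, fun i' => -(A' i').linear, fun i' => A' i' 0, ?_, fun i' c => by
    rw [hA', hdec]⟩
  have hset : {u : ι' → ℝ | u ∈ affineSpan ℝ (convexHull ℝ (Set.range w)) ∧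
      ∀ i', (-(A' i').linear) u ≤ A' i' 0} =
      {u | u ∈ affineSpan ℝ (Set.range w) ∧ ∀ i', 0 ≤ A' i' u} := by
    ext u
    simp only [Set.mem_ofPred_eq, affineSpan_convexHull]
    refine and_congr_right fun _ => forall_congr' fun i' => ?_
    rw [hdec i' u, sub_nonneg]
  rw [hset]
  apply Set.Subset.antisymm
  · intro u hu
    refine ⟨convexHull_subset_affineSpan _ hu, fun i' => ?_⟩
    have hconv : Convex ℝ {u | 0 ≤ A' i' u} := (convex_Ici (0 : ℝ)).affine_preimage (A' i')
    exact convexHull_min (by rintro _ ⟨c, rfl⟩; change 0 ≤ A' i' (w c); rw [← hA']; exact hS' i' c)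
      hconv hu
  · rintro u ⟨hu, hpos⟩
    -- On the affine hull of the face each inequality of `P` is either one of the new ones or a
    -- nonnegative constant, so the embedded point satisfies all of them.
    have hLu : L u ∈ P := by
      rw [hPab]
      refine ⟨?_, fun i => ?_⟩
      · rw [hP, affineSpan_convexHull]
        have h1 : L u ∈ (affineSpan ℝ (Set.range w)).map L := ⟨u, hu, rfl⟩
        rw [AffineSubspace.map_span] at h1
        refine affineSpan_mono ℝ ?_ h1
        rintro _ ⟨_, ⟨c, rfl⟩, rfl⟩
        exact ⟨lift c, (hLw c).symm⟩
      · have : 0 ≤ A i u := by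
          rcases hrow' i with ⟨i', hi'⟩ | ⟨s, hs, hi⟩
          · rw [hlinW (f := A i) (f' := A' i') (fun c => by rw [hAw, hi', hA']) u hu]
            exact hpos i'
          · rw [hlinW (f := A i) (f' := AffineMap.const ℝ _ s)
              (fun c => by rw [hAw, hi]; rfl) u hu]
            exact hs
        rw [hA] at this
        linarith
    rw [hP] at hLu
    have hface := mem_convexHull_face (by rintro _ ⟨j, rfl⟩; exact hv j) (Set.range g)ᶜ ht hLu
      (hLt u)
    have hsub : {y ∈ Set.range v | ∀ e ∈ (Set.range g)ᶜ, y e = t e} ⊆ L '' Set.range w := by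
      rintro _ ⟨⟨j, rfl⟩, hj⟩
      obtain ⟨c, hc⟩ := hsurj j hj
      exact ⟨w c, ⟨c, rfl⟩, by rw [hLw, hc]⟩
    have h2 := convexHull_mono hsub hface
    rw [← AffineMap.image_convexHull] at h2
    obtain ⟨u', hu', he⟩ := h2
    have : u' = u := by
      ext m
      rw [← hLg u' m, he, hLg]
    rwa [← this]

/-! ### Constructing 2-sums with uniform matroids -/

/-- The uniform matroid of rank `k` on a finite set. -/
lemma exists_isUniform {β : Type*} {E : Set β} {d k : ℕ} (hE : E.encard = d) (hkd : k ≤ d) :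
    ∃ N : Matroid β, N.E = E ∧ IsUniform N d k := by
  have hfin : E.Finite := Set.finite_of_encard_eq_coe hE
  refine ⟨Matroid.ofIsBaseOfFinite hfin (fun B => B ⊆ E ∧ B.encard = k) ?_ ?_ fun B h => h.1,
    rfl, hE, fun B => Iff.rfl⟩
  · exact Set.exists_subset_encard_eq (by rw [hE]; exact_mod_cast hkd)
  · rintro B B' ⟨hB, hBk⟩ ⟨hB', hBk'⟩ a ha
    have : ∃ b ∈ B', b ∉ B := by
      by_contra! h
      have := Set.Finite.eq_of_subset_of_encard_le (hfin.subset hB') h (by rw [hBk, hBk'])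
      exact ha.2 (this ▸ ha.1)
    obtain ⟨b, hb, hbB⟩ := this
    refine ⟨b, ⟨hb, hbB⟩, Set.insert_subset (hB' hb) (Set.sdiff_subset.trans hB), ?_⟩
    rw [Set.encard_exchange hbB ha.1, hBk]

/-- If the bases of `M` are the sets obtained by gluing the `k`-subsets of the range of `ε` with the
members of `𝓗` along `none`, then `𝓗` is the set of bases of a matroid, and `M` is a 2-sum. -/
theorem exists_isTwoSum {α : Type*} {M : Matroid α} [M.Finite] {d k : ℕ} (hk : 1 ≤ k) (hkd : k < d)
    {ε : Fin d → Option α} (hε : Function.Injective ε) {q₀ : Fin d} (hq₀ : ε q₀ = none)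
    {F : Set α} (hF : ∀ e ∈ F, some e ∉ Set.range ε)
    (hE : some '' M.E = (Set.range ε ∪ some '' F) \ {none})
    {𝓗 : Set (Set (Option α))} (hH : ∀ H ∈ 𝓗, H ⊆ insert none (some '' F))
    (h1 : ∃ H ∈ 𝓗, none ∈ H) (h0 : ∃ H ∈ 𝓗, none ∉ H)
    (hB : ∀ B, M.IsBase B ↔ ∃ T : Finset (Fin d), T.card = k ∧ ∃ H ∈ 𝓗,
      (none ∈ H ↔ q₀ ∉ T) ∧ some '' B = (ε '' T ∪ H) \ {none}) :
    ∃ M₁ M₂ : Matroid (Option α), IsUniform M₁ d k ∧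
      IsTwoSum (M.mapEmbedding Function.Embedding.some) M₁ M₂ none ∧
      M₂.E = insert none (some '' F) ∧ ∀ D, M₂.IsBase D ↔ D ∈ 𝓗 := by
  classical
  have hd : 2 ≤ d := by omega
  have : Nontrivial (Fin d) := Fin.nontrivial_iff_two_le.2 hd
  -- The element over `q₁` will stand for `none`: bases whose coordinate part is `X` or `X ∪ {q₁}`
  -- correspond to members of `𝓗`.
  obtain ⟨q₁, hq₁⟩ := exists_ne q₀
  obtain ⟨X, hX1, hX0, hXk⟩ := exists_finset_pair_compl hk hkd hq₁
  obtain ⟨e₁, he₁⟩ : ∃ e₁, ε q₁ = some e₁ :=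
    Option.ne_none_iff_exists'.1 fun h => hq₁ (hε (h.trans hq₀.symm))
  have he₁F : e₁ ∉ F := fun h => hF e₁ h ⟨q₁, he₁⟩
  -- lifting a member of `𝓗` to a base
  let lift : Set (Option α) → Set α := fun D =>
    {e | some e ∈ ε '' X ∨ some e ∈ D ∨ (e = e₁ ∧ none ∈ D)}
  have he₁X : some e₁ ∉ ε '' X := by
    rintro ⟨q, hq, h⟩
    exact hX1 (by rwa [← hε (h.trans he₁.symm)])
  have he₁D : ∀ {D}, D ⊆ insert none (some '' F) → some e₁ ∉ D := by
    intro D hD h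
    rcases hD h with h | ⟨e, he, h⟩
    · simp at h
    · exact he₁F (by rwa [← Option.some.inj h])
  have hlift : ∀ D ∈ 𝓗, M.IsBase (lift D) := by
    intro D hD
    rw [hB]
    by_cases hn : none ∈ D
    · refine ⟨insert q₁ X, by rw [Finset.card_insert_of_notMem hX1, hXk], D, hD,
        by simp [hn, hX0, hq₁.symm], ?_⟩
      ext o
      cases o with
      | none => simp
      | some e =>
        simp only [Set.mem_image, Option.some.injEq, exists_eq_right, Finset.coe_insert, lift,
          Set.mem_sdiff, Set.mem_union, Set.image_insert_eq, Set.mem_insert_iff, he₁, hn,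
          Set.mem_ofPred_eq]
        simp
        exact ⟨by rintro (h | h | h) <;> simp [h], by rintro ((h | h) | h) <;> simp [h]⟩
    · refine ⟨insert q₀ X, by rw [Finset.card_insert_of_notMem hX0, hXk], D, hD,
        by simp [hn], ?_⟩
      ext o
      cases o with
      | none => simp
      | some e =>
        simp only [Set.mem_image, Option.some.injEq, exists_eq_right, Finset.coe_insert, lift,
          Set.mem_sdiff, Set.mem_union, Set.image_insert_eq, Set.mem_insert_iff, hq₀, hn,
          Set.mem_ofPred_eq]
        simp
  have hunlift : ∀ D, D ⊆ insert none (some '' F) → M.IsBase (lift D) → D ∈ 𝓗 := by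
    intro D hDF hD
    obtain ⟨T, hT, H, hH𝓗, hHT, hBT⟩ := (hB _).1 hD
    have hmem : ∀ e, e ∈ lift D ↔ some e ∈ ε '' T ∨ some e ∈ H := by
      intro e
      have : some e ∈ some '' lift D ↔ some e ∈ (ε '' T ∪ H) \ {none} := by rw [hBT]
      simpa using this
    have hεsome : ∀ q, q ≠ q₀ → ∃ e, ε q = some e := fun q hq =>
      Option.ne_none_iff_exists'.1 fun h => hq (hε (h.trans hq₀.symm))
    have hεmem : ∀ q e, ε q = some e → (e ∈ lift D ↔ q ∈ T) := by
      intro q e hqe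
      rw [hmem, ← hqe, hε.mem_set_image]
      refine ⟨?_, fun h => Or.inl h⟩
      rintro (h | h)
      · exact h
      · exfalso
        rcases hH H hH𝓗 h with h | ⟨f, hf, h⟩
        · rw [hqe] at h; simp at h
        · exact hF f hf ⟨q, h.symm⟩
    have hXT : X ⊆ T := by
      intro q hq
      obtain ⟨e, he⟩ := hεsome q (fun h => hX0 (h ▸ hq))
      rw [← hεmem q e he]
      exact Or.inl ⟨q, hq, he⟩
    have hTX : ∀ q ∈ T, q ∈ X ∨ q = q₁ ∨ q = q₀ := by
      intro q hq
      by_contra! hcon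
      obtain ⟨e, he⟩ := hεsome q hcon.2.2
      rcases (hεmem q e he).2 hq with h | h | h
      · rw [← he, hε.mem_set_image] at h
        exact hcon.1 h
      · rcases hDF h with h | ⟨f, hf, h⟩
        · simp at h
        · exact hF f hf ⟨q, he.trans h.symm⟩
      · exact hcon.2.1 (hε (by rw [he, he₁, h.1]))
    have hq₁T : q₁ ∈ T ↔ none ∈ D := by
      rw [← hεmem q₁ e₁ he₁]
      refine ⟨?_, fun h => Or.inr (Or.inr ⟨rfl, h⟩)⟩
      rintro (h | h | h)
      · exact absurd h he₁X
      · exact absurd h (he₁D hDF)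
      · exact h.2
    -- Cardinality: a `k`-set between `X` and `X ∪ {q₀, q₁}` contains exactly one of `q₀` and `q₁`.
    have hnone : none ∈ H ↔ none ∈ D := by
      rw [hHT, ← hq₁T]
      constructor
      · intro h
        by_contra h'
        have : T ⊆ X := fun q hq => by
          rcases hTX q hq with h2 | rfl | rfl
          · exact h2
          · exact absurd hq h'
          · exact absurd hq h
        have := Finset.card_le_card this
        omega
      · intro h h'
        have h2 : insert q₀ (insert q₁ X) ⊆ T :=
          Finset.insert_subset h' (Finset.insert_subset h hXT)
        have h3 := Finset.card_le_card h2
        rw [Finset.card_insert_of_notMem (by simp [hX0, hq₁.symm]),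
          Finset.card_insert_of_notMem hX1] at h3
        omega
    have hDH : D = H := by
      ext o
      cases o with
      | none => exact hnone.symm
      | some e =>
        by_cases heF : e ∈ F
        · have he : e ≠ e₁ := fun h => he₁F (h ▸ heF)
          have hX' : some e ∉ ε '' X := fun ⟨q, _, h⟩ => hF e heF ⟨q, h⟩
          have hT' : some e ∉ ε '' T := fun ⟨q, _, h⟩ => hF e heF ⟨q, h⟩
          have := hmem e
          simp only [lift, Set.mem_ofPred_eq, hX', he, hT'] at this
          simpa using this
        · have haux : ∀ {D : Set (Option α)}, D ⊆ insert none (some '' F) → some e ∉ D := by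
            intro D hD h
            rcases hD h with h | ⟨f, hf, h⟩
            · simp at h
            · exact heF (by rwa [← Option.some.inj h])
          exact iff_of_false (haux hDF) (haux (hH H hH𝓗))
    rwa [hDH]
  have hFfin : F.Finite := by
    have h2 : some '' F ⊆ some '' M.E := by
      rw [hE]
      rintro _ ⟨e, he, rfl⟩
      exact ⟨Or.inr ⟨e, he, rfl⟩, by simp⟩
    exact M.ground_finite.subset ((Set.image_subset_image_iff (Option.some_injective α)).1 h2)
  have hGfin : (insert none (some '' F) : Set (Option α)).Finite := (hFfin.image _).insert _
  have hexch : Matroid.ExchangeProperty (· ∈ 𝓗) := by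
    intro D D' hD hD' a ha
    have hDF := hH D hD
    have hDF' := hH D' hD'
    -- lifting of elements
    let ψ : Option α → α := fun o => o.getD e₁
    have hψX : ∀ o ∈ (insert none (some '' F) : Set (Option α)), some (ψ o) ∉ ε '' X := by
      rintro o (rfl | ⟨e, he, rfl⟩)
      · exact he₁X
      · exact fun ⟨q, _, h⟩ => hF e he ⟨q, h⟩
    have hψinj : Set.InjOn ψ (insert none (some '' F)) := by
      rintro o (rfl | ⟨e, he, rfl⟩) o' (rfl | ⟨e', he', rfl⟩) h
      · rfl
      · exact absurd he' (by change e₁ = e' at h; rwa [← h])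
      · exact absurd he (by change e = e₁ at h; rwa [h])
      · change e = e' at h; rw [h]
    have hliftψ : ∀ D e, e ∈ lift D ↔ some e ∈ ε '' X ∨ ∃ o ∈ D, ψ o = e := by
      intro D e
      refine or_congr Iff.rfl ⟨?_, ?_⟩
      · rintro (h | ⟨rfl, h⟩)
        · exact ⟨_, h, rfl⟩
        · exact ⟨_, h, rfl⟩
      · rintro ⟨_ | f, h, rfl⟩
        · exact Or.inr ⟨rfl, h⟩
        · exact Or.inl h
    have haG := hDF ha.1
    -- Both lifted bases contain all of `X`, so the exchange in `M` brings in `ψ b` for some `b ∈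
    -- D'` and can be pulled back to `𝓗`.
    obtain ⟨f, ⟨hf', hf⟩, hbase⟩ := (hlift D hD).exchange (hlift D' hD') (e := ψ a) ⟨by
        rw [hliftψ]; exact Or.inr ⟨a, ha.1, rfl⟩, by
        rw [hliftψ]
        rintro (h | ⟨o, ho, h⟩)
        · exact hψX a haG h
        · exact ha.2 (by rwa [← hψinj (hDF' ho) haG h])⟩
    rw [hliftψ] at hf' hf
    obtain ⟨b, hb, rfl⟩ : ∃ o ∈ D', ψ o = f := hf'.resolve_left fun h => hf (Or.inl h)
    refine ⟨b, ⟨hb, fun h => hf (Or.inr ⟨b, h, rfl⟩)⟩, ?_⟩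
    refine hunlift _ (Set.insert_subset (hDF' hb) (Set.sdiff_subset.trans hDF)) ?_
    convert hbase using 1
    ext e
    rw [hliftψ, Set.mem_insert_iff, Set.mem_sdiff, hliftψ, Set.mem_singleton_iff]
    constructor
    · rintro (h | ⟨o, rfl | ho, rfl⟩)
      · exact Or.inr ⟨Or.inl h, fun he => hψX a haG (he ▸ h)⟩
      · exact Or.inl rfl
      · exact Or.inr ⟨Or.inr ⟨o, ho.1, rfl⟩, fun h => ho.2 (hψinj (hDF ho.1) haG h)⟩
    · rintro (rfl | ⟨h | ⟨o, ho, rfl⟩, hne⟩)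
      · exact Or.inr ⟨b, Or.inl rfl, rfl⟩
      · exact Or.inl h
      · exact Or.inr ⟨o, Or.inr ⟨ho, fun h => hne (by rw [Set.mem_singleton_iff.1 h])⟩, rfl⟩
  obtain ⟨M₁, hM₁E, hM₁⟩ := exists_isUniform (E := Set.range ε) (d := d) (k := k)
    (by rw [← Set.image_univ, hε.encard_image, Set.encard_univ]; simp) hkd.le
  have hM₁B : ∀ T : Finset (Fin d), T.card = k → M₁.IsBase (ε '' T) := by
    intro T hT
    rw [hM₁.2, hM₁E, hε.encard_image, Set.encard_coe_eq_coe_finsetCard, hT]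
    exact ⟨Set.image_subset_range _ _, rfl⟩
  have hnT : ∀ T : Finset (Fin d), none ∈ ε '' T ↔ q₀ ∈ T := by
    intro T
    rw [← hq₀, hε.mem_set_image, Finset.mem_coe]
  refine ⟨M₁, Matroid.ofIsBaseOfFinite hGfin (· ∈ 𝓗) (h1.imp fun _ h => h.1) hexch hH, hM₁, ?_, rfl,
    fun D => Iff.rfl⟩
  refine ⟨?_, ?_, ?_, ?_, ?_, ?_, ?_⟩
  · rw [hM₁E, Matroid.ofIsBaseOfFinite_E]
    ext o
    constructor
    · rintro ⟨h, rfl | ⟨e, he, rfl⟩⟩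
      · rfl
      · exact absurd h (hF e he)
    · rintro rfl
      exact ⟨⟨q₀, hq₀⟩, Or.inl rfl⟩
  · rw [Matroid.isLoop_iff_forall_mem_compl_isBase]
    intro h
    exact (h _ (hM₁B (insert q₀ X) (by rw [Finset.card_insert_of_notMem hX0, hXk]))).2
      ((hnT _).2 (by simp))
  · rw [Matroid.isColoop_iff_forall_mem_isBase]
    intro h
    have := (hnT _).1 (h (hM₁B (insert q₁ X) (by rw [Finset.card_insert_of_notMem hX1, hXk])))
    simp [hX0, hq₁.symm] at this
  · rw [Matroid.isLoop_iff_forall_mem_compl_isBase]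
    intro h
    obtain ⟨H, hH1, hn⟩ := h1
    exact (h H hH1).2 hn
  · rw [Matroid.isColoop_iff_forall_mem_isBase]
    intro h
    obtain ⟨H, hH0, hn⟩ := h0
    exact hn (h hH0)
  · change some '' M.E = _
    rw [hE, hM₁E, Matroid.ofIsBaseOfFinite_E]
    ext o
    cases o <;> simp
  · intro B
    rw [Matroid.mapEmbedding_isBase_iff]
    change M.IsBase (some ⁻¹' B) ∧ B ⊆ Set.range some ↔ _
    constructor
    · rintro ⟨h, hBr⟩
      obtain ⟨T, hT, H, hH𝓗, hHT, hBT⟩ := (hB _).1 h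
      refine ⟨ε '' T, H, hM₁B T hT, hH𝓗, ?_, ?_⟩
      · rw [Set.mem_symmDiff, hnT, hHT]
        tauto
      · rw [← hBT, Set.image_preimage_eq_of_subset hBr]
    · rintro ⟨B₁, H, hB₁, hH𝓗, hs, rfl⟩
      obtain ⟨hB₁E, hB₁k⟩ := (hM₁.2 B₁).1 hB₁
      rw [hM₁E] at hB₁E
      obtain ⟨T, rfl⟩ : ∃ T : Finset (Fin d), ε '' T = B₁ :=
        ⟨(ε ⁻¹' B₁).toFinset, by simp [Set.image_preimage_eq_of_subset hB₁E]⟩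
      rw [hε.encard_image, Set.encard_coe_eq_coe_finsetCard] at hB₁k
      have hr : (ε '' T ∪ H) \ {none} ⊆ Set.range some := by
        rintro (_ | e) ho
        · simp at ho
        · exact ⟨e, rfl⟩
      refine ⟨(hB _).2 ⟨T, by exact_mod_cast hB₁k, H, hH𝓗, ?_, ?_⟩, hr⟩
      · rw [Set.mem_symmDiff, hnT] at hs
        have : (none : Option α) ∈ H ↔ q₀ ∉ T := by tauto
        exact this
      · rw [Set.image_preimage_eq_of_subset hr]

/-! ### Matroids whose bases are glued from a hypersimplex and another family -/

/-- The bases of `M` are the sets `𝓑 c₁ c₂`, where `c₁` and `c₂` agree in one bit, which is a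
coordinate of the `k`-set `τ c₁`.  Membership of an element in `𝓑 c₁ c₂` depends on one other
coordinate of `τ c₁` or on `c₂` alone, and `𝓑 c₁ c₂` determines the common bit and at least one
other coordinate of `τ c₁`. -/
structure GluedBases {α C₁ C₂ : Type*} {d : ℕ} (M : Matroid α) (k : ℕ) (τ : C₁ → Finset (Fin d))
    (q₀ : Fin d) (β : C₂ → Prop) (𝓑 : C₁ → C₂ → Set α) : Prop where
  card : ∀ c, (τ c).card = k
  surj : ∀ T : Finset (Fin d), T.card = k → ∃ c, τ c = T
  exists_bit : ∃ c, β c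
  exists_not_bit : ∃ c, ¬ β c
  isBase : ∀ c₁ c₂, (q₀ ∈ τ c₁ ↔ β c₂) → M.IsBase (𝓑 c₁ c₂)
  exists_eq : ∀ B, M.IsBase B → ∃ c₁ c₂, (q₀ ∈ τ c₁ ↔ β c₂) ∧ 𝓑 c₁ c₂ = B
  mem_or : ∀ e ∈ M.E,
    (∃ q b, q ≠ q₀ ∧ ∀ c₁ c₂, (q₀ ∈ τ c₁ ↔ β c₂) → (e ∈ 𝓑 c₁ c₂ ↔ (q ∈ τ c₁ ↔ b = true))) ∨
    ∃ h : C₂ → Prop, ∀ c₁ c₂, (q₀ ∈ τ c₁ ↔ β c₂) → (e ∈ 𝓑 c₁ c₂ ↔ h c₂)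
  bit_iff : ∀ c₁ c₂ c₁' c₂', (q₀ ∈ τ c₁ ↔ β c₂) → (q₀ ∈ τ c₁' ↔ β c₂') →
    𝓑 c₁ c₂ = 𝓑 c₁' c₂' → (q₀ ∈ τ c₁ ↔ q₀ ∈ τ c₁')
  exists_coord : ∃ q, q ≠ q₀ ∧ ∀ c₁ c₂ c₁' c₂', (q₀ ∈ τ c₁ ↔ β c₂) → (q₀ ∈ τ c₁' ↔ β c₂') →
    𝓑 c₁ c₂ = 𝓑 c₁' c₂' → (q ∈ τ c₁ ↔ q ∈ τ c₁')

lemma exists_third {d : ℕ} (hd : 3 ≤ d) (q r : Fin d) : ∃ a, a ≠ q ∧ a ≠ r := by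
  obtain ⟨a, -, ha⟩ := Finset.exists_mem_notMem_of_card_lt_card (s := {q, r})
    (t := (Finset.univ : Finset (Fin d)))
    (Finset.card_le_two.trans_lt (by rw [Finset.card_univ, Fintype.card_fin]; omega))
  exact ⟨a, by simpa [not_or] using ha⟩

namespace GluedBases

variable {α C₁ C₂ : Type*} {d k : ℕ} {M : Matroid α} {τ : C₁ → Finset (Fin d)} {q₀ : Fin d}
  {β : C₂ → Prop} {𝓑 : C₁ → C₂ → Set α}

lemma exists_right (G : GluedBases M k τ q₀ β 𝓑) (c₁ : C₁) : ∃ c₂, q₀ ∈ τ c₁ ↔ β c₂ := by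
  by_cases h : q₀ ∈ τ c₁
  · exact G.exists_bit.imp fun c hc => iff_of_true h hc
  · exact G.exists_not_bit.imp fun c hc => iff_of_false h hc

/-- If `q` and `r` differ from `q₀`, one `c₂` fits both columns, and the bases differ only through
these two coordinates. If one of them is `q₀`, the common bit flips while the coordinates other than
`q` and `r` stay fixed. -/
lemma exists_swap (G : GluedBases M k τ q₀ β 𝓑) (hk : 1 ≤ k) (hkd : k < d) {q r : Fin d}
    (hqr : q ≠ r) : ∃ c c', q ∈ τ c ∧ r ∉ τ c ∧ q ∉ τ c' ∧ r ∈ τ c' ∧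
      ∀ a, a ≠ q → a ≠ r → (a ∈ τ c ↔ a ∈ τ c') := by
  obtain ⟨T, T', hT, hT', h⟩ := exists_finset_swap hk hkd hqr
  obtain ⟨c, rfl⟩ := G.surj T hT
  obtain ⟨c', rfl⟩ := G.surj T' hT'
  exact ⟨c, c', h⟩

/-- A signed version of `exists_swap`. -/
lemma exists_swap' (G : GluedBases M k τ q₀ β 𝓑) (hk : 1 ≤ k) (hkd : k < d) {q r : Fin d}
    (hqr : q ≠ r) (b : Bool) : ∃ c c', (q ∈ τ c ↔ b = true) ∧ ¬ (q ∈ τ c' ↔ b = true) ∧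
      ¬ (r ∈ τ c ↔ b = true) ∧ (r ∈ τ c' ↔ b = true) ∧
      ∀ a, a ≠ q → a ≠ r → (a ∈ τ c ↔ a ∈ τ c') := by
  obtain ⟨c, c', h1, h2, h3, h4, h5⟩ := G.exists_swap hk hkd hqr
  cases b
  · exact ⟨c', c, by simp [h3], by simp [h1], by simp [h4], by simp [h2],
      fun a ha ha' => (h5 a ha ha').symm⟩
  · exact ⟨c, c', by simp [h1], by simp [h3], by simp [h2], by simp [h4], h5⟩

/-- Complementing the hypersimplex. -/
lemma compl (G : GluedBases M k τ q₀ β 𝓑) (hkd : k ≤ d) :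
    GluedBases M (d - k) (fun c => (τ c)ᶜ) q₀ (fun c => ¬ β c) 𝓑 := by
  have hiff : ∀ c₁ c₂, (q₀ ∈ (τ c₁)ᶜ ↔ ¬ β c₂) ↔ (q₀ ∈ τ c₁ ↔ β c₂) := fun c₁ c₂ => by
    rw [Finset.mem_compl, not_iff_not]
  refine ⟨fun c => ?_, fun T hT => ?_, G.exists_not_bit, ?_, ?_, ?_, ?_, ?_, ?_⟩
  · rw [Finset.card_compl, Fintype.card_fin, G.card]
  · obtain ⟨c, hc⟩ := G.surj Tᶜ (by rw [Finset.card_compl, Fintype.card_fin, hT]; omega)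
    exact ⟨c, by simp [hc]⟩
  · simpa using G.exists_bit
  · simpa only [hiff] using G.isBase
  · simpa only [hiff] using G.exists_eq
  · intro e he
    simp only [hiff]
    refine (G.mem_or e he).imp_left ?_
    rintro ⟨q, b, hq, h⟩
    refine ⟨q, !b, hq, fun c₁ c₂ hc => (h c₁ c₂ hc).trans ?_⟩
    cases b <;> simp
  · simp only [hiff]
    intro c₁ c₂ c₁' c₂' h h' he
    rw [Finset.mem_compl, Finset.mem_compl, G.bit_iff c₁ c₂ c₁' c₂' h h' he]
  · obtain ⟨q, hq, h⟩ := G.exists_coord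
    simp only [hiff]
    refine ⟨q, hq, fun c₁ c₂ c₁' c₂' h1 h2 he => ?_⟩
    rw [Finset.mem_compl, Finset.mem_compl, h c₁ c₂ c₁' c₂' h1 h2 he]

lemma eq_of_mem_iff (G : GluedBases M k τ q₀ β 𝓑) [M.Finite] (hM : IsConnected M) {e f : α}
    (he : e ∈ M.E) (hf : f ∈ M.E)
    (h : ∀ c₁ c₂, (q₀ ∈ τ c₁ ↔ β c₂) → (e ∈ 𝓑 c₁ c₂ ↔ f ∈ 𝓑 c₁ c₂)) : e = f := by
  by_contra hef
  refine hM.not_forall_mem_isBase_iff he hf hef fun B hB => ?_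
  obtain ⟨c₁, c₂, hc, rfl⟩ := G.exists_eq B hB
  exact h c₁ c₂ hc

/-- The two elements would be a separating pair, hence all of `M`, so a base would depend on the
coordinate `q` only. Swapping `q₀` with a third coordinate changes the common bit but not the base,
against `bit_iff`. -/
lemma not_complementary (G : GluedBases M k τ q₀ β 𝓑) [M.Finite] (hM : IsConnected M)
    (hk : 1 ≤ k) (hkd : k < d) (hd : 3 ≤ d) {e f : α} (he : e ∈ M.E) (hf : f ∈ M.E) {q : Fin d}
    (hq : q ≠ q₀) {b b' : Bool} (hb : b ≠ b')
    (h : ∀ c₁ c₂, (q₀ ∈ τ c₁ ↔ β c₂) → (e ∈ 𝓑 c₁ c₂ ↔ (q ∈ τ c₁ ↔ b = true)))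
    (h' : ∀ c₁ c₂, (q₀ ∈ τ c₁ ↔ β c₂) → (f ∈ 𝓑 c₁ c₂ ↔ (q ∈ τ c₁ ↔ b' = true))) : False := by
  have hE : M.E ⊆ {e, f} := by
    refine hM.ground_subset_pair he hf fun B hB => ?_
    obtain ⟨c₁, c₂, hc, rfl⟩ := G.exists_eq B hB
    rw [h c₁ c₂ hc, h' c₁ c₂ hc]
    cases b <;> cases b' <;> simp at hb ⊢
  obtain ⟨r, hrq, hr⟩ := exists_third hd q q₀
  obtain ⟨c, c', h1, -, h3, -, h5⟩ := G.exists_swap hk hkd hr.symm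
  obtain ⟨c₂, hc⟩ := G.exists_right c
  obtain ⟨c₂', hc'⟩ := G.exists_right c'
  refine h3 ((G.bit_iff c c₂ c' c₂' hc hc' ?_).1 h1)
  have hqc := h5 q hq hrq.symm
  ext a
  by_cases ha : a ∈ M.E
  · rcases hE ha with rfl | rfl
    · rw [h _ _ hc, h _ _ hc', hqc]
    · rw [h' _ _ hc, h' _ _ hc', hqc]
  · exact iff_of_false (fun h => ha ((G.isBase _ _ hc).subset_ground h))
      (fun h => ha ((G.isBase _ _ hc').subset_ground h))

/-- Swapping `q` with a third coordinate changes membership of `e` with `c₂` held fixed. -/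
lemma not_right (G : GluedBases M k τ q₀ β 𝓑) (hk : 1 ≤ k) (hkd : k < d) (hd : 3 ≤ d) {e : α}
    {q : Fin d} (hq : q ≠ q₀) {b : Bool}
    (h : ∀ c₁ c₂, (q₀ ∈ τ c₁ ↔ β c₂) → (e ∈ 𝓑 c₁ c₂ ↔ (q ∈ τ c₁ ↔ b = true))) :
    ¬ ∃ h : C₂ → Prop, ∀ c₁ c₂, (q₀ ∈ τ c₁ ↔ β c₂) → (e ∈ 𝓑 c₁ c₂ ↔ h c₂) := by
  rintro ⟨h', hh'⟩
  obtain ⟨r, hrq, hr⟩ := exists_third hd q q₀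
  obtain ⟨c, c', h1, -, h3, -, h5⟩ := G.exists_swap hk hkd hrq.symm
  obtain ⟨c₂, hc⟩ := G.exists_right c
  have hc' : q₀ ∈ τ c' ↔ β c₂ := by rw [← h5 q₀ hq.symm hr.symm, hc]
  have h6 := (h c c₂ hc).symm.trans ((hh' c c₂ hc).trans ((hh' c' c₂ hc').symm.trans (h c' c₂ hc')))
  cases b <;> simp [h1, h3] at h6

/-- Swapping `q` and `r` with `c₂` fixed removes `e` from the base, so some `f` must enter. Only an
element over `q` or `r` can change; over `q` it would be complementary to `e`, so it lies over `r`,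
with the same sign. -/
lemma exists_over (G : GluedBases M k τ q₀ β 𝓑) [M.Finite] (hM : IsConnected M)
    (hk : 1 ≤ k) (hkd : k < d) (hd : 3 ≤ d) {e : α} (he : e ∈ M.E) {q r : Fin d}
    (hq : q ≠ q₀) (hr : r ≠ q₀) {b : Bool}
    (h : ∀ c₁ c₂, (q₀ ∈ τ c₁ ↔ β c₂) → (e ∈ 𝓑 c₁ c₂ ↔ (q ∈ τ c₁ ↔ b = true))) :
    ∃ f ∈ M.E, ∀ c₁ c₂, (q₀ ∈ τ c₁ ↔ β c₂) → (f ∈ 𝓑 c₁ c₂ ↔ (r ∈ τ c₁ ↔ b = true)) := by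
  rcases eq_or_ne q r with rfl | hqr
  · exact ⟨e, he, h⟩
  obtain ⟨c, c', h1, h2, h3, h4, h5⟩ := G.exists_swap' hk hkd hqr b
  obtain ⟨c₂, hc⟩ := G.exists_right c
  have hc' : q₀ ∈ τ c' ↔ β c₂ := by rw [← h5 q₀ hq.symm hr.symm, hc]
  have heB : e ∈ 𝓑 c c₂ := (h _ _ hc).2 h1
  have heB' : e ∉ 𝓑 c' c₂ := fun h' => h2 ((h _ _ hc').1 h')
  obtain ⟨f, hf', hf⟩ : ∃ f ∈ 𝓑 c' c₂, f ∉ 𝓑 c c₂ := by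
    by_contra! hcon
    have := (G.isBase _ _ hc').eq_of_subset_isBase (G.isBase _ _ hc) hcon
    exact heB' (this ▸ heB)
  have hfE : f ∈ M.E := (G.isBase _ _ hc').subset_ground hf'
  rcases G.mem_or f hfE with ⟨q', b', hq', hq'b⟩ | ⟨h', hh'⟩
  · rw [hq'b _ _ hc] at hf
    rw [hq'b _ _ hc'] at hf'
    rcases eq_or_ne q' q with rfl | h6
    · refine (G.not_complementary hM hk hkd hd he hfE hq (b := b) (b' := b') ?_ h hq'b).elim
      rintro rfl
      exact hf h1
    rcases eq_or_ne q' r with rfl | h7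
    · have : b = b' := by
        by_contra hb
        apply hf
        cases b <;> cases b' <;> simp_all
      subst this
      exact ⟨f, hfE, hq'b⟩
    · rw [h5 q' h6 h7] at hf
      exact absurd hf' hf
  · rw [hh' _ _ hc] at hf
    rw [hh' _ _ hc'] at hf'
    exact absurd hf' hf

/-- Up to complementing the hypersimplex, all coordinates but the common one are elements. -/
lemma exists_sign (G : GluedBases M k τ q₀ β 𝓑) [M.Finite] (hM : IsConnected M)
    (hk : 1 ≤ k) (hkd : k < d) (hd : 3 ≤ d) :
    ∃ b : Bool, ∀ q, q ≠ q₀ → ∃ e ∈ M.E,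
      ∀ c₁ c₂, (q₀ ∈ τ c₁ ↔ β c₂) → (e ∈ 𝓑 c₁ c₂ ↔ (q ∈ τ c₁ ↔ b = true)) := by
  by_cases hL : ∃ e ∈ M.E, ∃ q b, q ≠ q₀ ∧
      ∀ c₁ c₂, (q₀ ∈ τ c₁ ↔ β c₂) → (e ∈ 𝓑 c₁ c₂ ↔ (q ∈ τ c₁ ↔ b = true))
  · obtain ⟨e, he, q, b, hq, h⟩ := hL
    exact ⟨b, fun r hr => G.exists_over hM hk hkd hd he hq hr h⟩
  -- If all elements depended on `c₂` alone, a swap at the coordinate from `exists_coord` that fixes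
  -- `q₀` would leave the base unchanged.
  · exfalso
    obtain ⟨q, hq, hqc⟩ := G.exists_coord
    obtain ⟨r, hrq, hr⟩ := exists_third hd q q₀
    obtain ⟨c, c', h1, -, h3, -, h5⟩ := G.exists_swap hk hkd hrq.symm
    obtain ⟨c₂, hc⟩ := G.exists_right c
    have hc' : q₀ ∈ τ c' ↔ β c₂ := by rw [← h5 q₀ hq.symm hr.symm, hc]
    refine h3 ((hqc c c₂ c' c₂ hc hc' ?_).1 h1)
    ext a
    by_cases ha : a ∈ M.E
    · rcases G.mem_or a ha with h | ⟨h, hh⟩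
      · exact absurd ⟨a, ha, h⟩ hL
      · rw [hh _ _ hc, hh _ _ hc']
    · exact iff_of_false (fun h => ha ((G.isBase _ _ hc).subset_ground h))
        (fun h => ha ((G.isBase _ _ hc').subset_ground h))

/-- If all coordinates but the common one are elements, then no complement of a coordinate is. -/
lemma not_complement (G : GluedBases M k τ q₀ β 𝓑) [M.Finite] (hM : IsConnected M)
    (hk : 1 ≤ k) (hkd : k < d) (hd : 3 ≤ d) {el : Fin d → α} (hel : ∀ q, q ≠ q₀ → el q ∈ M.E)
    (h : ∀ q, q ≠ q₀ → ∀ c₁ c₂, (q₀ ∈ τ c₁ ↔ β c₂) → (el q ∈ 𝓑 c₁ c₂ ↔ q ∈ τ c₁))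
    {e : α} (he : e ∈ M.E) {q : Fin d}
    (heq : ∀ c₁ c₂, (q₀ ∈ τ c₁ ↔ β c₂) → (e ∈ 𝓑 c₁ c₂ ↔ q ∉ τ c₁)) : False := by
  rcases ne_or_eq q q₀ with hq | rfl
  · exact G.not_complementary hM hk hkd hd (hel q hq) he hq (b := true) (b' := false) (by simp)
      (by simpa using h q hq) (by simpa using heq)
  obtain ⟨q₁, hq₁, -⟩ := exists_third hd q q
  obtain ⟨r, hrq, hr⟩ := exists_third hd q₁ q
  have he₁ : el q₁ ≠ e := by
    rintro rfl
    obtain ⟨c, c', h1, -, h3, -, h5⟩ := G.exists_swap hk hkd hrq.symm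
    obtain ⟨c₂, hc⟩ := G.exists_right c
    obtain ⟨c₂', hc'⟩ := G.exists_right c'
    have h6 := (h q₁ hq₁ _ _ hc).symm.trans (heq _ _ hc)
    have h7 := (h q₁ hq₁ _ _ hc').symm.trans (heq _ _ hc')
    have h8 := h5 q hq₁.symm hr.symm
    tauto
  -- Remaining case: `e` is the complement of the common coordinate. Exchanging `e` out of a base
  -- over `X ∪ {q₁}` turns the common coordinate on and keeps the elements over `X` and `q₁`, so the
  -- new set would have `k + 1` members.
  obtain ⟨X, hX1, hX0, hXk⟩ := exists_finset_pair_compl hk hkd hq₁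
  obtain ⟨c, hcX⟩ := G.surj (insert q₁ X) (by rw [Finset.card_insert_of_notMem hX1, hXk])
  obtain ⟨c', hcX'⟩ := G.surj (insert q X) (by rw [Finset.card_insert_of_notMem hX0, hXk])
  obtain ⟨c₂, hc⟩ := G.exists_right c
  obtain ⟨c₂', hc'⟩ := G.exists_right c'
  have hB := G.isBase _ _ hc
  have hB' := G.isBase _ _ hc'
  have heB : e ∈ 𝓑 c c₂ := by rw [heq _ _ hc, hcX]; simp [hX0, hq₁.symm]
  have heB' : e ∉ 𝓑 c' c₂' := by rw [heq _ _ hc', hcX']; simp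
  obtain ⟨f, hf, hfB⟩ := hB.exchange hB' ⟨heB, heB'⟩
  obtain ⟨a, a₂, ha, haB⟩ := G.exists_eq _ hfB
  have hqa : q ∈ τ a := by
    by_contra hcon
    have h1 : e ∈ 𝓑 a a₂ := (heq _ _ ha).2 hcon
    rw [haB] at h1
    rcases h1 with rfl | h1
    · exact hf.2 heB
    · exact h1.2 rfl
  have hmem : ∀ p, p ≠ q → el p ≠ e → p ∈ τ c → p ∈ τ a := by
    intro p hp hpe hpc
    rw [← h p hp _ _ ha, haB]
    exact Or.inr ⟨(h p hp _ _ hc).2 hpc, hpe⟩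
  have hsub : insert q (insert q₁ X) ⊆ τ a := by
    refine Finset.insert_subset hqa (Finset.insert_subset (hmem q₁ hq₁ he₁ (by simp [hcX])) ?_)
    intro p hp
    have hpq : p ≠ q := fun h => hX0 (h ▸ hp)
    refine hmem p hpq ?_ (by simp [hcX, hp])
    rintro rfl
    exact heB' ((h p hpq _ _ hc').2 (by simp [hcX', hp]))
  have := Finset.card_le_card hsub
  rw [G.card, Finset.card_insert_of_notMem (by simp [hX0, hq₁.symm]),
    Finset.card_insert_of_notMem hX1] at this
  omega

end GluedBases

/-! ### Traces of bases, and the resulting 2-sums -/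

/-- The trace of `B` on `F`, together with the new element `none` in the role of `e₁`. -/
def faceBase {α : Type*} (e₁ : α) (F B : Set α) : Set (Option α) :=
  {o | (o = none ∧ e₁ ∈ B) ∨ ∃ e ∈ F, o = some e ∧ e ∈ B}

lemma none_mem_faceBase {α : Type*} {e₁ : α} {F B : Set α} :
    none ∈ faceBase e₁ F B ↔ e₁ ∈ B := by
  simp [faceBase]

lemma some_mem_faceBase {α : Type*} {e₁ : α} {F B : Set α} {e : α} :
    some e ∈ faceBase e₁ F B ↔ e ∈ F ∧ e ∈ B := by
  simp [faceBase]

lemma faceBase_subset {α : Type*} (e₁ : α) (F B : Set α) :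
    faceBase e₁ F B ⊆ insert none (some '' F) := by
  rintro o (⟨rfl, -⟩ | ⟨e, he, rfl, -⟩)
  · exact Or.inl rfl
  · exact Or.inr ⟨e, he, rfl⟩

/-- The map `l` chooses, for each `c₂`, a compatible column in which `q₁` carries the opposite of
the common bit. Thus `el q₁` represents the new element in the trace of `𝓑 (l c₂) c₂`. Elements of
`F` depend on `c₂` only, so this trace loses nothing. -/
lemma GluedBases.exists_isTwoSum {α C₁ C₂ : Type*} {d k : ℕ} {M : Matroid α}
    {τ : C₁ → Finset (Fin d)} {q₀ : Fin d} {β : C₂ → Prop} {𝓑 : C₁ → C₂ → Set α}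
    (G : GluedBases M k τ q₀ β 𝓑) [M.Finite] (hM : IsConnected M)
    (hk : 1 ≤ k) (hkd : k < d) (hd : 3 ≤ d) {el : Fin d → α} (hel : ∀ q, q ≠ q₀ → el q ∈ M.E)
    (h : ∀ q, q ≠ q₀ → ∀ c₁ c₂, (q₀ ∈ τ c₁ ↔ β c₂) → (el q ∈ 𝓑 c₁ c₂ ↔ q ∈ τ c₁))
    {q₁ : Fin d} (hq₁ : q₁ ≠ q₀) {l : C₂ → C₁} (hl0 : ∀ c, q₀ ∈ τ (l c) ↔ β c)
    (hl1 : ∀ c, q₁ ∈ τ (l c) ↔ ¬ β c) {F : Set α}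
    (hF : F = {e ∈ M.E | ∃ h : C₂ → Prop, ∀ c₁ c₂, (q₀ ∈ τ c₁ ↔ β c₂) → (e ∈ 𝓑 c₁ c₂ ↔ h c₂)}) :
    (∀ e, e ∈ M.E ↔ e ∈ F ∨ ∃ q, q ≠ q₀ ∧ el q = e) ∧
    (∀ q, q ≠ q₀ → el q ∉ F) ∧
    (∀ q r, q ≠ q₀ → r ≠ q₀ → el q = el r → q = r) ∧
    ∃ M₁ M₂ : Matroid (Option α), IsUniform M₁ d k ∧
      IsTwoSum (M.mapEmbedding Function.Embedding.some) M₁ M₂ none ∧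
      M₂.E = insert none (some '' F) ∧
      ∀ D, M₂.IsBase D ↔ ∃ c, D = faceBase (el q₁) F (𝓑 (l c) c) := by
  classical
  have hinj : ∀ q r, q ≠ q₀ → r ≠ q₀ → el q = el r → q = r := by
    intro q r hq hr hqr
    by_contra hne
    obtain ⟨c, c', h1, h2, -⟩ := G.exists_swap hk hkd hne
    obtain ⟨c₂, hc⟩ := G.exists_right c
    exact h2 ((h r hr _ _ hc).1 (hqr ▸ (h q hq _ _ hc).2 h1))
  have helF : ∀ q, q ≠ q₀ → el q ∉ F := by
    intro q hq hqF
    rw [hF] at hqF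
    exact G.not_right hk hkd hd hq (b := true) (by simpa using h q hq) hqF.2
  have hEiff : ∀ e, e ∈ M.E ↔ e ∈ F ∨ ∃ q, q ≠ q₀ ∧ el q = e := by
    intro e
    constructor
    · intro he
      rcases G.mem_or e he with ⟨q, b, hq, hqb⟩ | hR
      · cases b with
        | true =>
          refine Or.inr ⟨q, hq, G.eq_of_mem_iff hM (hel q hq) he fun c₁ c₂ hc => ?_⟩
          rw [h q hq _ _ hc, hqb _ _ hc]
          simp
        | false =>
          exact (G.not_complement hM hk hkd hd hel h he (q := q) (by simpa using hqb)).elim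
      · exact Or.inl (by rw [hF]; exact ⟨he, hR⟩)
    · rintro (he | ⟨q, hq, rfl⟩)
      · rw [hF] at he; exact he.1
      · exact hel q hq
  refine ⟨hEiff, helF, hinj, ?_⟩
  let ε : Fin d → Option α := fun q => if q = q₀ then none else some (el q)
  have hε₀ : ε q₀ = none := if_pos rfl
  have hεs : ∀ q e, ε q = some e ↔ q ≠ q₀ ∧ el q = e := by
    intro q e
    by_cases hq : q = q₀ <;> simp [ε, hq]
  have hε : Function.Injective ε := by
    intro q r hqr
    cases hr : ε r with
    | none =>
      have haux : ∀ q, ε q = none → q = q₀ := fun q hq => by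
        by_contra h; simp [ε, h] at hq
      rw [haux q (hqr.trans hr), haux r hr]
    | some e =>
      obtain ⟨h1, h2⟩ := (hεs _ _).1 hr
      obtain ⟨h3, h4⟩ := (hεs _ _).1 (hqr.trans hr)
      exact hinj q r h3 h1 (h4.trans h2.symm)
  have hFε : ∀ e ∈ F, some e ∉ Set.range ε := by
    rintro e he ⟨q, hq⟩
    obtain ⟨h1, rfl⟩ := (hεs _ _).1 hq
    exact helF q h1 he
  have hkey : ∀ c₁ c₂, (q₀ ∈ τ c₁ ↔ β c₂) →
      some '' 𝓑 c₁ c₂ = (ε '' τ c₁ ∪ faceBase (el q₁) F (𝓑 (l c₂) c₂)) \ {none} := by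
    intro c₁ c₂ hc
    ext o
    cases o with
    | none => simp
    | some e =>
      have h1 : some e ∈ some '' 𝓑 c₁ c₂ ↔ e ∈ 𝓑 c₁ c₂ := by simp
      have h2 : some e ∈ (ε '' τ c₁ ∪ faceBase (el q₁) F (𝓑 (l c₂) c₂)) \ {none} ↔
          (∃ q ∈ τ c₁, ε q = some e) ∨ (e ∈ F ∧ e ∈ 𝓑 (l c₂) c₂) := by
        rw [Set.mem_sdiff, Set.mem_union, some_mem_faceBase]
        simp
      rw [h1, h2]
      by_cases heE : e ∈ M.E
      · rcases (hEiff e).1 heE with heF | ⟨q, hq, rfl⟩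
        · have : ¬ ∃ q ∈ τ c₁, ε q = some e := fun ⟨q, _, h⟩ => hFε e heF ⟨q, h⟩
          simp only [this, heF, true_and, false_or]
          rw [hF] at heF
          obtain ⟨-, hR, hh⟩ := heF
          rw [hh _ _ hc, hh _ _ (hl0 c₂)]
        · simp only [helF q hq, false_and, or_false]
          rw [h q hq _ _ hc]
          constructor
          · exact fun hqc => ⟨q, hqc, (hεs _ _).2 ⟨hq, rfl⟩⟩
          · rintro ⟨r, hr, hrq⟩
            obtain ⟨h3, h4⟩ := (hεs _ _).1 hrq
            rwa [← hinj r q h3 hq h4]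
      · refine iff_of_false (fun h => heE ((G.isBase _ _ hc).subset_ground h)) ?_
        rintro (⟨q, -, hq⟩ | ⟨heF, -⟩)
        · exact heE ((hEiff e).2 (Or.inr ⟨q, (hεs _ _).1 hq⟩))
        · exact heE ((hEiff e).2 (Or.inl heF))
  have hnone : ∀ c, none ∈ faceBase (el q₁) F (𝓑 (l c) c) ↔ ¬ β c := fun c => by
    rw [none_mem_faceBase, h q₁ hq₁ _ _ (hl0 c), hl1]
  have hres := MatroidSlack.exists_isTwoSum (M := M) hk hkd hε hε₀ hFε
    (𝓗 := Set.range fun c => faceBase (el q₁) F (𝓑 (l c) c)) ?_ ?_ ?_ ?_ ?_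
  · obtain ⟨M₁, M₂, h1, h2, h3, h4⟩ := hres
    refine ⟨M₁, M₂, h1, h2, h3, fun D => ?_⟩
    rw [h4]
    exact exists_congr fun c => eq_comm
  · ext o
    cases o with
    | none => simp
    | some e =>
      have : some e ∈ some '' M.E ↔ e ∈ M.E := by simp
      rw [this, hEiff e, Set.mem_sdiff, Set.mem_union, Set.mem_range]
      simp only [hεs]
      simp [or_comm]
  · rintro _ ⟨c, rfl⟩
    exact faceBase_subset _ _ _
  · obtain ⟨c, hc⟩ := G.exists_not_bit
    exact ⟨_, ⟨c, rfl⟩, (hnone c).2 hc⟩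
  · obtain ⟨c, hc⟩ := G.exists_bit
    exact ⟨_, ⟨c, rfl⟩, fun h => (hnone c).1 h hc⟩
  · intro B
    constructor
    · intro hB
      obtain ⟨c₁, c₂, hc, rfl⟩ := G.exists_eq B hB
      exact ⟨τ c₁, G.card c₁, _, ⟨c₂, rfl⟩, by rw [hnone, hc], hkey c₁ c₂ hc⟩
    · rintro ⟨T, hT, _, ⟨c₂, rfl⟩, hn, hB⟩
      obtain ⟨c₁, rfl⟩ := G.surj T hT
      have hc : q₀ ∈ τ c₁ ↔ β c₂ := not_iff_not.1 (hn.symm.trans (hnone c₂))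
      rw [← hkey c₁ c₂ hc] at hB
      rw [(Option.some_injective α).image_injective hB]
      exact G.isBase _ _ hc

/-- Every matroid with an element `e₁` that is neither a loop nor a coloop is a 2-sum
with `U_{2,1}`. -/
lemma exists_isTwoSum_two {α : Type*} {M : Matroid α} [M.Finite] {e₁ : α}
    (h1 : ∃ B, M.IsBase B ∧ e₁ ∈ B) (h0 : ∃ B, M.IsBase B ∧ e₁ ∉ B) :
    ∃ M₁ M₂ : Matroid (Option α), IsUniform M₁ 2 1 ∧
      IsTwoSum (M.mapEmbedding Function.Embedding.some) M₁ M₂ none ∧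
      M₂.E = insert none (some '' (M.E \ {e₁})) ∧
      ∀ D, M₂.IsBase D ↔ ∃ B, M.IsBase B ∧ faceBase e₁ (M.E \ {e₁}) B = D := by
  -- `U_{2,1}` lives on the new element and `e₁`; then `M₂` is `M` with `e₁` renamed `none`.
  let ε : Fin 2 → Option α := ![none, some e₁]
  have he₁ : e₁ ∈ M.E := by
    obtain ⟨B, hB, h⟩ := h1
    exact hB.subset_ground h
  have hεs : ∀ q e, ε q = some e ↔ q = 1 ∧ e = e₁ := by
    intro q e
    fin_cases q <;> simp [ε, eq_comm]
  have hε : Function.Injective ε := by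
    intro q r h
    fin_cases q <;> fin_cases r <;> simp_all [ε]
  have hT01 : ∀ T : Finset (Fin 2), T.card = 1 → (1 ∈ T ↔ 0 ∉ T) := by decide
  have hkey : ∀ (T : Finset (Fin 2)) (B : Set α), T.card = 1 → M.IsBase B → (e₁ ∈ B ↔ 0 ∉ T) →
      some '' B = (ε '' T ∪ faceBase e₁ (M.E \ {e₁}) B) \ {none} := by
    intro T B hT hB h
    rw [← hT01 T hT] at h
    ext o
    cases o with
    | none => simp
    | some e =>
      have h3 : some e ∈ (ε '' T ∪ faceBase e₁ (M.E \ {e₁}) B) \ {none} ↔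
          (∃ q ∈ T, ε q = some e) ∨ (e ∈ M.E \ {e₁} ∧ e ∈ B) := by
        rw [Set.mem_sdiff, Set.mem_union, some_mem_faceBase]
        simp
      have h4 : some e ∈ some '' B ↔ e ∈ B := by simp
      rw [h3, h4]
      simp only [hεs]
      constructor
      · intro he
        by_cases hee : e = e₁
        · subst hee
          exact Or.inl ⟨1, h.1 he, rfl, rfl⟩
        · exact Or.inr ⟨⟨hB.subset_ground he, hee⟩, he⟩
      · rintro (⟨q, hq, rfl, rfl⟩ | ⟨-, he⟩)
        · exact h.2 hq
        · exact he
  have hres := exists_isTwoSum (M := M) (k := 1) le_rfl (by norm_num) hε (q₀ := 0) rfl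
    (F := M.E \ {e₁})
    (𝓗 := {D | ∃ B, M.IsBase B ∧ faceBase e₁ (M.E \ {e₁}) B = D}) ?_ ?_ ?_ ?_ ?_ ?_
  · exact hres
  · rintro e ⟨-, he⟩ ⟨q, hq⟩
    exact he ((hεs _ _).1 hq).2
  · ext o
    cases o with
    | none => simp
    | some e =>
      have h4 : some e ∈ some '' M.E ↔ e ∈ M.E := by simp
      rw [h4, Set.mem_sdiff, Set.mem_union, Set.mem_range]
      simp only [hεs]
      by_cases hee : e = e₁
      · simp [hee, he₁]
      · simp [hee]
  · rintro _ ⟨B, -, rfl⟩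
    exact faceBase_subset _ _ _
  · obtain ⟨B, hB, h⟩ := h1
    exact ⟨_, ⟨B, hB, rfl⟩, none_mem_faceBase.2 h⟩
  · obtain ⟨B, hB, h⟩ := h0
    exact ⟨_, ⟨B, hB, rfl⟩, fun h' => h (none_mem_faceBase.1 h')⟩
  · intro B
    constructor
    · intro hB
      by_cases heB : e₁ ∈ B
      · exact ⟨{1}, rfl, _, ⟨B, hB, rfl⟩, by simp [none_mem_faceBase, heB],
          hkey {1} B rfl hB (by simp [heB])⟩
      · exact ⟨{0}, rfl, _, ⟨B, hB, rfl⟩, by simp [none_mem_faceBase, heB],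
          hkey {0} B rfl hB (by simp [heB])⟩
    · rintro ⟨T, hT, _, ⟨B', hB', rfl⟩, hn, h⟩
      rw [none_mem_faceBase] at hn
      rw [← hkey T B' hT hB' hn] at h
      rwa [(Option.some_injective α).image_injective h]

/-! ### Slack matrices of base polytopes -/

lemma IsSlackMatrixAt.reindex {V R C R' C' : Type*} [AddCommGroup V] [Module ℝ V]
    {S : Matrix R C ℝ} {S' : Matrix R' C' ℝ} {P : Set V} {v : C → V} (hS : IsSlackMatrixAt S P v)
    (ρ : R ≃ R') (γ : C ≃ C') (h : S = S'.submatrix ρ γ) :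
    IsSlackMatrixAt S' P (v ∘ γ.symm) := by
  obtain ⟨hP, a, b, hab, hSab⟩ := hS
  refine ⟨by rw [hP, γ.symm.surjective.range_comp], a ∘ ρ.symm, b ∘ ρ.symm, ?_, fun i j => ?_⟩
  · refine hab.trans ?_
    ext z
    refine and_congr_right fun _ => ?_
    exact ⟨fun h i => h _, fun h i => by simpa using h (ρ i)⟩
  · have := hSab (ρ.symm i) (γ.symm j)
    rw [h] at this
    simpa using this

lemma IsSlackMatrixAt.row_eq {V R C : Type*} [AddCommGroup V] [Module ℝ V]
    {S : Matrix R C ℝ} {P : Set V} {v : C → V} (hS : IsSlackMatrixAt S P v) {j j' : C}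
    (h : v j = v j') (i : R) : S i j = S i j' := by
  obtain ⟨-, a, b, -, hSab⟩ := hS
  rw [hSab, hSab, h]

/-- The points of a 0/1 slack presentation of a base polytope are the bases. -/
lemma range_eq_of_basePolytope {α C : Type*} {M : Matroid α} {v : C → M.E → ℝ}
    (hP : basePolytope M = convexHull ℝ (Set.range v)) (hv : ∀ j e, v j e = 0 ∨ v j e = 1) :
    Set.range v = {x | ∃ B, M.IsBase B ∧
      x = fun e : M.E => B.indicator (fun _ => (1 : ℝ)) (e : α)} := by
  have hind : ∀ x ∈ {x | ∃ B, M.IsBase B ∧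
      x = fun e : M.E => B.indicator (fun _ => (1 : ℝ)) (e : α)}, ∀ e, x e = 0 ∨ x e = 1 := by
    rintro _ ⟨B, -, rfl⟩ e
    by_cases h : (e : α) ∈ B <;> simp [h]
  have hv' : ∀ x ∈ Set.range v, ∀ e, x e = 0 ∨ x e = 1 := by
    rintro _ ⟨j, rfl⟩
    exact hv j
  apply Set.Subset.antisymm
  · intro x hx
    refine mem_of_mem_convexHull_of_zero_one hind (hv' x hx) ?_
    change x ∈ basePolytope M
    rw [hP]
    exact subset_convexHull ℝ _ hx
  · intro x hx
    refine mem_of_mem_convexHull_of_zero_one hv' (hind x hx) ?_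
    rw [← hP]
    exact subset_convexHull ℝ _ hx

/-- If the coordinate face of `B(M)` given by the columns `l` of the first factor is the base
polytope of `M₂`, then the second factor of a 2-product gives a slack matrix of it. -/
lemma isSlackMatrix_addComplement {α R₁ C₁ R₂ C₂ : Type*} {M : Matroid α}
    {S₁ : Matrix R₁ C₁ ℝ} {x : R₁} {S₂ : Matrix R₂ C₂ ℝ} {y : R₂} (hy : IsSpecialRow S₂ y)
    {P : Set (M.E → ℝ)} {v : TwoProductCol S₁ x S₂ y → M.E → ℝ}
    (hS : IsSlackMatrixAt (twoProduct S₁ x S₂ y) P v)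
    (h01 : ∀ i j, twoProduct S₁ x S₂ y i j = 0 ∨ twoProduct S₁ x S₂ y i j = 1)
    {𝓑 : C₁ → C₂ → Set α}
    (hv : ∀ j e, v j e = (𝓑 j.1.1 j.1.2).indicator (fun _ => (1 : ℝ)) (e : α))
    {e₁ : α} {F X : Set α} (he₁ : e₁ ∈ M.E) (hF : F ⊆ M.E) (he₁F : e₁ ∉ F) {l : C₂ → C₁}
    (hl : ∀ c, S₁ x (l c) = S₂ y c)
    (hX : ∀ c, ∀ e ∈ M.E, e ∉ F → e ≠ e₁ → (e ∈ 𝓑 (l c) c ↔ e ∈ X))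
    (hsurj : ∀ c₁ c₂, S₁ x c₁ = S₂ y c₂ →
      (∀ e ∈ M.E, e ∉ F → e ≠ e₁ → (e ∈ 𝓑 c₁ c₂ ↔ e ∈ X)) → ∃ c, 𝓑 c₁ c₂ = 𝓑 (l c) c)
    (hrow : ∀ i, (∀ c, S₁ i (l c) = S₂ y c) ∨ (∀ c, S₁ i (l c) = 1 - S₂ y c) ∨
      ∃ s, 0 ≤ s ∧ ∀ c, S₁ i (l c) = s)
    {M₂ : Matroid (Option α)} (hM₂E : M₂.E = insert none (some '' F))
    (hM₂ : ∀ D, M₂.IsBase D ↔ ∃ c, D = faceBase e₁ F (𝓑 (l c) c)) :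
    IsSlackMatrix (addComplement S₂ y) (basePolytope M₂) := by
  classical
  have hgE : ∀ m : M₂.E, m.1.getD e₁ ∈ M.E := by
    rintro ⟨m, hm⟩
    rw [hM₂E] at hm
    rcases hm with rfl | ⟨e, he, rfl⟩
    · exact he₁
    · exact hF he
  -- Coordinates of `M₂` become coordinates of `M`, with `none` read as `e₁`; all others are frozen
  -- to the indicator of `X`.
  let g : M₂.E → M.E := fun m => ⟨m.1.getD e₁, hgE m⟩
  have hg : Function.Injective g := by
    rintro ⟨m, hm⟩ ⟨m', hm'⟩ h
    have h' : m.getD e₁ = m'.getD e₁ := congrArg Subtype.val h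
    rw [hM₂E] at hm hm'
    rcases hm with rfl | ⟨e, he, rfl⟩ <;> rcases hm' with rfl | ⟨e', he', rfl⟩
    · rfl
    · exact absurd he' (by rwa [← (show e₁ = e' from h')])
    · exact absurd he (by rwa [(show e = e₁ from h')])
    · rw [Subtype.mk.injEq, show e = e' from h']
  have hrange : ∀ e : M.E, e ∈ Set.range g ↔ (e : α) ∈ F ∨ (e : α) = e₁ := by
    intro e
    constructor
    · rintro ⟨⟨m, hm⟩, rfl⟩
      rw [hM₂E] at hm
      rcases hm with rfl | ⟨e, he, rfl⟩
      · exact Or.inr rfl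
      · exact Or.inl he
    · rintro (h | h)
      · exact ⟨⟨some e, by rw [hM₂E]; exact Or.inr ⟨_, h, rfl⟩⟩, rfl⟩
      · exact ⟨⟨none, by rw [hM₂E]; exact Or.inl rfl⟩, Subtype.ext h.symm⟩
  let lift : C₂ → TwoProductCol S₁ x S₂ y := fun c => ⟨(l c, c), hl c⟩
  let t : M.E → ℝ := fun e => X.indicator (fun _ => (1 : ℝ)) (e : α)
  have hind : ∀ (A : Set α) (e : α), A.indicator (fun _ => (1 : ℝ)) e = 0 ∨
      A.indicator (fun _ => (1 : ℝ)) e = 1 := by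
    intro A e
    by_cases h : e ∈ A <;> simp [h]
  have hiff : ∀ (A A' : Set α) (e : α), A.indicator (fun _ => (1 : ℝ)) e =
      A'.indicator (fun _ => (1 : ℝ)) e ↔ (e ∈ A ↔ e ∈ A') := by
    intro A A' e
    by_cases h : e ∈ A <;> by_cases h' : e ∈ A' <;> simp [h, h']
  have hS2 : ∀ i, ∃ r, ∀ c', twoProduct S₁ x S₂ y r (lift c') = S₂ i c' := by
    intro i
    by_cases hi : i = y
    · exact ⟨Sum.inr (Sum.inr ()), fun c' => by rw [hi]; exact hl c'⟩
    · exact ⟨Sum.inr (Sum.inl ⟨i, hi⟩), fun c' => rfl⟩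
  have hface := hS.face (fun j e => by rw [hv]; exact hind _ _) (S' := addComplement S₂ y)
    ?_ g hg t (fun e _ => hind _ _) lift ?_ ?_ ?_ ?_
  · refine ⟨fun c => v (lift c) ∘ g, ?_⟩
    · have hset : {x | ∃ B, M₂.IsBase B ∧
          x = fun e : M₂.E => B.indicator (fun _ => (1 : ℝ)) (e : Option α)} =
          Set.range fun c => v (lift c) ∘ g := by
        have hw : ∀ c, (fun e : M₂.E => (faceBase e₁ F (𝓑 (l c) c)).indicator
            (fun _ => (1 : ℝ)) (e : Option α)) = v (lift c) ∘ g := by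
          intro c
          ext ⟨m, hm⟩
          rw [Function.comp_apply, hv]
          rw [hM₂E] at hm
          rcases hm with rfl | ⟨e, he, rfl⟩
          · change _ = (𝓑 (l c) c).indicator (fun _ => (1 : ℝ)) e₁
            by_cases h : e₁ ∈ 𝓑 (l c) c <;> simp [h, none_mem_faceBase]
          · change _ = (𝓑 (l c) c).indicator (fun _ => (1 : ℝ)) e
            by_cases h : e ∈ 𝓑 (l c) c <;> simp [h, he, some_mem_faceBase]
        ext z
        constructor
        · rintro ⟨B, hB, rfl⟩
          obtain ⟨c, rfl⟩ := (hM₂ B).1 hB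
          exact ⟨c, (hw c).symm⟩
        · rintro ⟨c, rfl⟩
          exact ⟨_, (hM₂ _).2 ⟨c, rfl⟩, (hw c).symm⟩
      rw [basePolytope, hset]
      exact hface
  · rintro (_ | i) c
    · change 0 ≤ 1 - S₂ y c
      rcases hy.1 c with h | h <;> simp [h]
    · obtain ⟨r, hr⟩ := hS2 i
      change 0 ≤ S₂ i c
      rw [← hr c]
      rcases h01 r (lift c) with h | h <;> simp [h]
  · intro c e he
    rw [hrange, not_or] at he
    rw [hv]
    exact (hiff _ _ _).2 (hX c e e.2 he.1 he.2)
  · intro j hj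
    obtain ⟨c, hc⟩ := hsurj j.1.1 j.1.2 j.2 fun e he heF hee => by
      have := hj ⟨e, he⟩ (by rw [hrange, not_or]; exact ⟨heF, hee⟩)
      rw [hv] at this
      exact (hiff _ _ _).1 this
    refine ⟨c, ?_⟩
    ext e
    rw [hv, hv, hc]
  · rintro (_ | i)
    · exact ⟨Sum.inr (Sum.inr ()), Or.inr fun c => by
        change 1 - S₂ y c = 1 - S₁ x (l c)
        rw [hl]⟩
    · obtain ⟨r, hr⟩ := hS2 i
      exact ⟨r, Or.inl fun c => (hr c).symm⟩
  · rintro (i | i | i)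
    · rcases hrow i with h | h | h
      · exact Or.inl ⟨some y, h⟩
      · exact Or.inl ⟨none, h⟩
      · exact Or.inr h
    · exact Or.inl ⟨some i, fun c => rfl⟩
    · exact Or.inl ⟨some y, hl⟩

/-! ### The rows of the hypersimplex slack matrix -/

/-- The entry of the slack matrix of a hypersimplex at the row `r` and the column `s`. -/
noncomputable def literal {d : ℕ} (r : Fin d × Bool) (s : Finset (Fin d)) : ℝ :=
  if r.2 = true then (if r.1 ∈ s then 1 else 0) else (if r.1 ∈ s then 0 else 1)

lemma literal_eq {d : ℕ} (r : Fin d × Bool) (s : Finset (Fin d)) :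
    literal r s = if (r.1 ∈ s ↔ r.2 = true) then 1 else 0 := by
  unfold literal
  by_cases h : r.1 ∈ s <;> cases h' : r.2 <;> simp [h]

lemma literal_eq_one_iff {d : ℕ} (r : Fin d × Bool) (s : Finset (Fin d)) :
    literal r s = 1 ↔ (r.1 ∈ s ↔ r.2 = true) := by
  rw [literal_eq]
  split <;> simp_all

lemma literal_eq_zero_or_one {d : ℕ} (r : Fin d × Bool) (s : Finset (Fin d)) :
    literal r s = 0 ∨ literal r s = 1 := by
  rw [literal_eq]
  split <;> simp

lemma literal_congr {d : ℕ} {r : Fin d × Bool} {s s' : Finset (Fin d)}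
    (h : r.1 ∈ s ↔ r.1 ∈ s') : literal r s = literal r s' := by
  simp only [literal_eq, h]

lemma literal_eq_iff {d : ℕ} {r : Fin d × Bool} {s s' : Finset (Fin d)} :
    literal r s = literal r s' ↔ (r.1 ∈ s ↔ r.1 ∈ s') := by
  refine ⟨fun h => ?_, literal_congr⟩
  have := literal_eq_one_iff r s
  rw [h, literal_eq_one_iff] at this
  cases hb : r.2 <;> simp [hb] at this <;> tauto

lemma EqHypersimplexSlack.exists_equiv {R C : Type*} {S : Matrix R C ℝ} {x : R} {d k : ℕ}
    {σ : R → Fin d × Bool} (h : EqHypersimplexSlack S x d k σ) :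
    ∃ τ : C ≃ HypersimplexCol d k, ∀ i c, S i c = literal (σ i) (τ c).1 := by
  obtain ⟨τ, ⟨f, hf, hσ⟩ | ⟨f, hf, hσ⟩⟩ := h
  · refine ⟨τ, fun i c => ?_⟩
    rw [← hσ, hf]
    rfl
  · refine ⟨τ, fun i c => ?_⟩
    have := congrFun (congrFun hf (some i)) c
    rw [← hσ]
    exact this

/-- For `d ≥ 3`, there are rows for at least two coordinates. -/
lemma EqHypersimplexSlack.exists_row {R C : Type*} {S : Matrix R C ℝ} {x : R} {d k : ℕ}
    {σ : R → Fin d × Bool} (h : EqHypersimplexSlack S x d k σ) (hd : 3 ≤ d) (q₀ : Fin d) :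
    ∃ i, (σ i).1 ≠ q₀ := by
  have hrow : ∀ q : Fin d, ∃ r : HypersimplexRow d k, r.1.1 = q := by
    intro q
    by_cases hk : k = 1
    · exact ⟨⟨(q, true), fun _ => rfl, fun h => absurd hk h⟩, rfl⟩
    · exact ⟨⟨(q, false), fun h => absurd h hk, fun _ _ => rfl⟩, rfl⟩
  obtain ⟨τ, ⟨f, -, hσ⟩ | ⟨f, -, hσ⟩⟩ := h
  · obtain ⟨q, hq, -⟩ := exists_third hd q₀ q₀
    obtain ⟨r, hr⟩ := hrow q
    refine ⟨f.symm r, ?_⟩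
    rwa [← hσ, f.apply_symm_apply, hr]
  -- The added complement row is not a row of `S`, so its coordinate has to be avoided as well.
  · obtain ⟨q, hq, hq'⟩ := exists_third hd q₀ (f none).1.1
    obtain ⟨r, hr⟩ := hrow q
    cases hi : f.symm r with
    | none =>
      rw [Equiv.symm_apply_eq] at hi
      rw [← hi, hr] at hq'
      exact absurd rfl hq'
    | some i =>
      rw [Equiv.symm_apply_eq] at hi
      exact ⟨i, by rwa [← hσ, ← hi, hr]⟩

/-! ### The two cases of the main result -/

section

variable {α R₁ C₁ R₂ C₂ : Type*} {M : Matroid α} {S₁ : Matrix R₁ C₁ ℝ} {x : R₁}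
  {S₂ : Matrix R₂ C₂ ℝ} {y : R₂}

lemma exists_bases {v : TwoProductCol S₁ x S₂ y → M.E → ℝ}
    (hS : IsSlackMatrixAt (twoProduct S₁ x S₂ y) (basePolytope M) v)
    (hv : ∀ j e, v j e = 0 ∨ v j e = 1) :
    ∃ 𝓑 : C₁ → C₂ → Set α,
      (∀ c₁ c₂, S₁ x c₁ = S₂ y c₂ → M.IsBase (𝓑 c₁ c₂)) ∧
      (∀ B, M.IsBase B → ∃ c₁ c₂, S₁ x c₁ = S₂ y c₂ ∧ 𝓑 c₁ c₂ = B) ∧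
      (∀ j e, v j e = (𝓑 j.1.1 j.1.2).indicator (fun _ => (1 : ℝ)) (e : α)) := by
  classical
  have hr := range_eq_of_basePolytope hS.1 hv
  have hex : ∀ j, ∃ B, M.IsBase B ∧ v j = fun e : M.E => B.indicator (fun _ => (1 : ℝ)) (e : α) :=
    fun j => by
      have : v j ∈ Set.range v := ⟨j, rfl⟩
      rwa [hr] at this
  choose Bs hBs hvB using hex
  -- Incompatible pairs get the dummy value `∅`; every property is asserted only for compatible
  -- ones.
  let 𝓑 : C₁ → C₂ → Set α := fun c₁ c₂ =>
    if h : S₁ x c₁ = S₂ y c₂ then Bs ⟨(c₁, c₂), h⟩ else ∅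
  have h𝓑 : ∀ j : TwoProductCol S₁ x S₂ y, 𝓑 j.1.1 j.1.2 = Bs j := fun j => dif_pos j.2
  refine ⟨𝓑, ?_, ?_, ?_⟩
  · intro c₁ c₂ h
    rw [h𝓑 ⟨(c₁, c₂), h⟩]
    exact hBs _
  · intro B hB
    have : (fun e : M.E => B.indicator (fun _ => (1 : ℝ)) (e : α)) ∈ Set.range v := by
      rw [hr]
      exact ⟨B, hB, rfl⟩
    obtain ⟨j, hj⟩ := this
    refine ⟨j.1.1, j.1.2, j.2, ?_⟩
    rw [h𝓑]
    rw [hvB j] at hj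
    ext e
    by_cases heE : e ∈ M.E
    · have h1 := congrFun hj ⟨e, heE⟩
      change (Bs j).indicator (fun _ => (1 : ℝ)) e = B.indicator (fun _ => (1 : ℝ)) e at h1
      change e ∈ Bs j ↔ e ∈ B
      by_cases h2 : e ∈ Bs j <;> by_cases h3 : e ∈ B <;> simp [h2, h3] at h1 ⊢
    · exact iff_of_false (fun h => heE ((hBs j).subset_ground h))
        (fun h => heE (hB.subset_ground h))
  · intro j e
    rw [h𝓑, hvB j]

lemma IsSpecialRow.exists_eq {R C R' C' : Type*} {S : Matrix R C ℝ} {x : R} {S' : Matrix R' C' ℝ}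
    {y : R'} (hx : IsSpecialRow S x) (hy : IsSpecialRow S' y) (c' : C') : ∃ c, S x c = S' y c' := by
  rcases hy.1 c' with h | h <;> rw [h]
  · exact hx.2.1
  · exact hx.2.2

/-- The main result for `d = 2`. -/
lemma exists_isTwoSum_isSlackMatrix_two [M.Finite]
    {v : TwoProductCol S₁ x S₂ y → M.E → ℝ}
    (hS : IsSlackMatrixAt (twoProduct S₁ x S₂ y) (basePolytope M) v)
    (h01 : ∀ i j, twoProduct S₁ x S₂ y i j = 0 ∨ twoProduct S₁ x S₂ y i j = 1)
    (hv : ∀ j e, v j e = 0 ∨ v j e = 1)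
    (hx : IsSpecialRow S₁ x) (hy : IsSpecialRow S₂ y) {σ : R₁ → Fin 2 × Bool}
    (τ : C₁ ≃ HypersimplexCol 2 1) (hτ : ∀ i c, S₁ i c = literal (σ i) (τ c).1) :
    ∃ (M₁ M₂ : Matroid (Option α)) (p : Option α), IsUniform M₁ 2 1 ∧
      IsTwoSum (M.mapEmbedding Function.Embedding.some) M₁ M₂ p ∧
      IsSlackMatrix (addComplement S₂ y) (basePolytope M₂) := by
  obtain ⟨𝓑, hB, hB', hv𝓑⟩ := exists_bases hS hv
  choose l hl using fun c => hx.exists_eq hy c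
  have hpair : ∀ T T' : Finset (Fin 2), T.card = 1 → T'.card = 1 → ∀ q, (q ∈ T ↔ q ∈ T') →
      T = T' := by decide
  -- The two columns of `S_{2,1}` differ in every row, so the special entry determines the column of
  -- `S₁`.
  have huniq : ∀ c₁ c₂, S₁ x c₁ = S₂ y c₂ → c₁ = l c₂ := by
    intro c₁ c₂ h
    rw [← hl c₂, hτ, hτ, literal_eq_iff] at h
    exact τ.injective (Subtype.ext (hpair _ _ (τ c₁).2 (τ (l c₂)).2 _ h))
  -- an element that is neither a loop nor a coloop
  obtain ⟨e₁, h1, h0⟩ : ∃ e₁, (∃ B, M.IsBase B ∧ e₁ ∈ B) ∧ ∃ B, M.IsBase B ∧ e₁ ∉ B := by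
    -- Otherwise all bases coincide, but the special row takes both values.
    by_contra! hcon
    obtain ⟨-, ⟨c, hc⟩, ⟨c', hc'⟩⟩ := id hy
    have hveq : v ⟨(l c, c), hl c⟩ = v ⟨(l c', c'), hl c'⟩ := by
      ext e
      rw [hv𝓑, hv𝓑]
      have : (e : α) ∈ 𝓑 (l c) c ↔ (e : α) ∈ 𝓑 (l c') c' :=
        ⟨fun h => hcon e ⟨_, hB _ _ (hl c), h⟩ _ (hB _ _ (hl c')),
          fun h => hcon e ⟨_, hB _ _ (hl c'), h⟩ _ (hB _ _ (hl c))⟩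
      classical
      simp only [Set.indicator_apply, this]
    have := hS.row_eq hveq (Sum.inr (Sum.inr ()))
    change S₁ x (l c) = S₁ x (l c') at this
    rw [hl, hl, hc, hc'] at this
    exact zero_ne_one this
  have he₁ : e₁ ∈ M.E := by
    obtain ⟨B, hB, h⟩ := h1
    exact hB.subset_ground h
  obtain ⟨M₁, M₂, hM₁, hM, hM₂E, hM₂⟩ := exists_isTwoSum_two h1 h0
  refine ⟨M₁, M₂, none, hM₁, hM, ?_⟩
  -- No coordinate is frozen here, so the face is the whole polytope and `∅` is an arbitrary choice.
  refine isSlackMatrix_addComplement hy hS h01 hv𝓑 he₁ Set.sdiff_subset (by simp) (X := ∅) hl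
    (fun c e he heF hee => absurd ⟨he, hee⟩ heF)
    (fun c₁ c₂ h _ => ⟨c₂, by rw [huniq c₁ c₂ h]⟩) ?_ hM₂E fun D => ?_
  · intro i
    have hlit : ∀ T T' : Finset (Fin 2), T.card = 1 → T'.card = 1 → ∀ q q₀ : Fin 2,
        ((q ∈ T ↔ q ∈ T') ↔ (q₀ ∈ T ↔ q₀ ∈ T')) := by decide
    obtain ⟨-, ⟨c₀, hc₀⟩, -⟩ := id hy
    have hi01 : ∀ c, S₁ i c = 0 ∨ S₁ i c = 1 := fun c => by
      rw [hτ]; exact literal_eq_zero_or_one _ _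
    have hagree : ∀ c, (S₁ i (l c) = S₁ i (l c₀) ↔ S₂ y c = 0) := by
      intro c
      rw [← hc₀, ← hl c, ← hl c₀, hτ i, hτ i, hτ x, hτ x, literal_eq_iff, literal_eq_iff]
      exact hlit _ _ (τ _).2 (τ _).2 _ _
    rcases hi01 (l c₀) with h | h
    · refine Or.inl fun c => ?_
      have h' : S₁ i (l c) = 0 ↔ S₂ y c = 0 := by rw [← hagree c, h]
      rcases hi01 (l c) with h2 | h2
      · rw [h2, h'.1 h2]
      · rcases hy.1 c with h3 | h3
        · rw [h'.2 h3, h3]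
        · rw [h2, h3]
    · refine Or.inr (Or.inl fun c => ?_)
      have h' : S₁ i (l c) = 1 ↔ S₂ y c = 0 := by rw [← hagree c, h]
      rcases hi01 (l c) with h2 | h2
      · rcases hy.1 c with h3 | h3
        · rw [h'.2 h3, h3, sub_zero]
        · rw [h2, h3, sub_self]
      · rw [h2, h'.1 h2, sub_zero]
  · rw [hM₂]
    constructor
    · rintro ⟨B, hBB, rfl⟩
      obtain ⟨c₁, c₂, hc, rfl⟩ := hB' B hBB
      exact ⟨c₂, by rw [huniq c₁ c₂ hc]⟩
    · rintro ⟨c, rfl⟩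
      exact ⟨_, hB _ _ (hl c), rfl⟩

/-- The main result for `d ≥ 3`, if all coordinates but the common one are elements of `M`. -/
lemma GluedBases.exists_isTwoSum_isSlackMatrix [M.Finite] (hM : IsConnected M)
    {v : TwoProductCol S₁ x S₂ y → M.E → ℝ}
    (hS : IsSlackMatrixAt (twoProduct S₁ x S₂ y) (basePolytope M) v)
    (h01 : ∀ i j, twoProduct S₁ x S₂ y i j = 0 ∨ twoProduct S₁ x S₂ y i j = 1)
    (hy : IsSpecialRow S₂ y) {𝓑 : C₁ → C₂ → Set α}
    (hv𝓑 : ∀ j e, v j e = (𝓑 j.1.1 j.1.2).indicator (fun _ => (1 : ℝ)) (e : α))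
    {d k : ℕ} (hk : 1 ≤ k) (hkd : k < d) (hd : 3 ≤ d) {τ : C₁ → Finset (Fin d)}
    (hτ : Function.Injective τ) {q₀ : Fin d} {β : C₂ → Prop} (G : GluedBases M k τ q₀ β 𝓑)
    (hbit : ∀ c₁ c₂, (q₀ ∈ τ c₁ ↔ β c₂) ↔ S₁ x c₁ = S₂ y c₂)
    (hrow : ∀ i, ∃ r : Fin d × Bool, ∀ c, S₁ i c = literal r (τ c))
    (hxrow : ∃ b, ∀ c, S₁ x c = literal (q₀, b) (τ c))
    {el : Fin d → α} (hel : ∀ q, q ≠ q₀ → el q ∈ M.E)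
    (h : ∀ q, q ≠ q₀ → ∀ c₁ c₂, (q₀ ∈ τ c₁ ↔ β c₂) → (el q ∈ 𝓑 c₁ c₂ ↔ q ∈ τ c₁)) :
    ∃ (M₁ M₂ : Matroid (Option α)) (p : Option α), IsUniform M₁ d k ∧
      IsTwoSum (M.mapEmbedding Function.Embedding.some) M₁ M₂ p ∧
      IsSlackMatrix (addComplement S₂ y) (basePolytope M₂) := by
  classical
  obtain ⟨q₁, hq₁, -⟩ := exists_third hd q₀ q₀
  obtain ⟨X, hX1, hX0, hXk⟩ := exists_finset_pair_compl hk hkd hq₁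
  have hlex : ∀ c, ∃ c₁, τ c₁ = if β c then insert q₀ X else insert q₁ X := fun c => by
    refine G.surj _ ?_
    split
    · rw [Finset.card_insert_of_notMem hX0, hXk]
    · rw [Finset.card_insert_of_notMem hX1, hXk]
  choose l hl using hlex
  have hl0 : ∀ c, q₀ ∈ τ (l c) ↔ β c := fun c => by
    rw [hl]; by_cases hc : β c <;> simp [hc, hX0, hq₁.symm]
  have hl1 : ∀ c, q₁ ∈ τ (l c) ↔ ¬ β c := fun c => by
    rw [hl]; by_cases hc : β c <;> simp [hc, hX1, hq₁]
  have hlX : ∀ c q, q ≠ q₀ → q ≠ q₁ → (q ∈ τ (l c) ↔ q ∈ X) := fun c q h h' => by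
    rw [hl]; by_cases hc : β c <;> simp [hc, h, h']
  obtain ⟨hE, helF, hinj, M₁, M₂, hM₁, hM', hM₂E, hM₂⟩ :=
    G.exists_isTwoSum hM hk hkd hd hel h hq₁ hl0 hl1 rfl
  refine ⟨M₁, M₂, none, hM₁, hM', ?_⟩
  have hl' : ∀ c, S₁ x (l c) = S₂ y c := fun c => (hbit _ _).1 (hl0 c)
  have hXel : ∀ q, q ≠ q₀ → (el q ∈ el '' X ↔ q ∈ X) := by
    intro q hq
    constructor
    · rintro ⟨r, hr, hrq⟩
      rwa [← hinj r q (fun h => hX0 (h ▸ hr)) hq hrq]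
    · exact fun hqX => ⟨q, hqX, rfl⟩
  refine isSlackMatrix_addComplement hy hS h01 hv𝓑 (hel q₁ hq₁) (fun e he => he.1) (helF q₁ hq₁)
    (X := el '' X) hl' ?_ ?_ ?_ hM₂E hM₂
  · intro c e he heF hee
    obtain ⟨q, hq, rfl⟩ := ((hE e).1 he).resolve_left heF
    rw [h q hq _ _ (hl0 c), hXel q hq]
    exact hlX c q hq (fun h => hee (by rw [h]))
  · intro c₁ c₂ hc hcX
    rw [← hbit] at hc
    have hcX' : ∀ q, q ≠ q₀ → q ≠ q₁ → (q ∈ τ c₁ ↔ q ∈ X) := by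
      intro q hq hq'
      rw [← h q hq _ _ hc, ← hXel q hq]
      exact hcX _ (hel q hq) (helF q hq) fun he => hq' (hinj q q₁ hq hq₁ he)
    refine ⟨c₂, ?_⟩
    -- A column on the face agrees with `X` off `q₀` and `q₁`, so its bit at `q₀` and its
    -- cardinality fix it.
    have hsub : τ (l c₂) = τ c₁ := by
      rw [hl]
      by_cases hβ : β c₂
      · rw [if_pos hβ]
        refine Finset.eq_of_subset_of_card_le (Finset.insert_subset (hc.2 hβ) fun q hq => ?_) ?_
        · exact (hcX' q (fun h => hX0 (h ▸ hq)) (fun h => hX1 (h ▸ hq))).2 hq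
        · rw [G.card, Finset.card_insert_of_notMem hX0, hXk]
      · rw [if_neg hβ]
        refine (Finset.eq_of_subset_of_card_le (fun q hq => ?_) ?_).symm
        · rw [Finset.mem_insert]
          by_contra! hcon
          rcases eq_or_ne q q₀ with rfl | hqq
          · exact hβ (hc.1 hq)
          · exact hcon.2 ((hcX' q hqq hcon.1).1 hq)
        · rw [G.card, Finset.card_insert_of_notMem hX1, hXk]
    rw [hτ hsub]
  · intro i
    obtain ⟨⟨q, b⟩, hr⟩ := hrow i
    obtain ⟨b₀, hx⟩ := hxrow
    have hS₂ : ∀ c, S₂ y c = literal (q₀, b₀) (τ (l c)) := fun c => by rw [← hl', hx]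
    have hnegate : ∀ (p p' : Prop) [Decidable p] [Decidable p'], (p ↔ ¬ p') →
        (if p then (1 : ℝ) else 0) = 1 - if p' then 1 else 0 := by
      intro p p' _ _ h
      by_cases h' : p' <;> simp [h, h']
    have hcase : (∀ c, (q ∈ τ (l c) ↔ q₀ ∈ τ (l c))) ∨
        (∀ c, (q ∈ τ (l c) ↔ ¬ q₀ ∈ τ (l c))) →
        (∀ c, S₁ i (l c) = S₂ y c) ∨ (∀ c, S₁ i (l c) = 1 - S₂ y c) := by
      intro hc
      rcases eq_or_ne b b₀ with hb | hb
      · subst hb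
        rcases hc with hc | hc
        · exact Or.inl fun c => by rw [hr, hS₂, literal_eq, literal_eq]; simp only [hc c]
        · refine Or.inr fun c => ?_
          rw [hr, hS₂, literal_eq, literal_eq]
          apply hnegate
          rw [hc c]
          cases b <;> simp
      · rcases hc with hc | hc
        · refine Or.inr fun c => ?_
          rw [hr, hS₂, literal_eq, literal_eq]
          apply hnegate
          rw [hc c]
          cases b <;> cases b₀ <;> simp at hb ⊢
        · refine Or.inl fun c => ?_
          rw [hr, hS₂, literal_eq, literal_eq]
          congr 1
          simp only [hc c]
          cases b <;> cases b₀ <;> simp at hb ⊢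
    -- Along the chosen edge only `q₀` and `q₁` vary, in opposite directions; rows over any other
    -- coordinate are constant.
    by_cases hqq : q = q₀ ∨ q = q₁
    · rcases hcase (by
        rcases hqq with rfl | rfl
        · exact Or.inl fun c => Iff.rfl
        · exact Or.inr fun c => by rw [hl1, hl0]) with h | h
      · exact Or.inl h
      · exact Or.inr (Or.inl h)
    · rw [not_or] at hqq
      refine Or.inr (Or.inr ⟨literal (q, b) X, ?_, fun c => ?_⟩)
      · rcases literal_eq_zero_or_one (q, b) X with h | h <;> simp [h]
      · rw [hr]
        exact literal_congr (hlX c q hqq.1 hqq.2)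

end

/-- Each `x_e ≥ 0` is a row of the product and comes from `S₁`, from `S₂` or from the special row.
Since equal bases give equal columns, a base determines the common bit and every coordinate that has
a row in `S₁`. -/
lemma EqHypersimplexSlack.gluedBases {α R₁ C₁ R₂ C₂ : Type*} {M : Matroid α}
    {S₁ : Matrix R₁ C₁ ℝ} {x : R₁} {S₂ : Matrix R₂ C₂ ℝ} {y : R₂} (hy : IsSpecialRow S₂ y)
    {v : TwoProductCol S₁ x S₂ y → M.E → ℝ} {P : Set (M.E → ℝ)}
    (hS : IsSlackMatrixAt (twoProduct S₁ x S₂ y) P v)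
    (hnonneg : ∀ e : M.E, ∃ i, ∀ j, twoProduct S₁ x S₂ y i j = v j e)
    {d k : ℕ} (hd : 3 ≤ d) {σ : R₁ → Fin d × Bool} (hσ : EqHypersimplexSlack S₁ x d k σ)
    (τ : C₁ ≃ HypersimplexCol d k) (hτ : ∀ i c, S₁ i c = literal (σ i) (τ c).1)
    {β : C₂ → Prop}
    (hbit : ∀ c₁ c₂, ((σ x).1 ∈ (τ c₁).1 ↔ β c₂) ↔ S₁ x c₁ = S₂ y c₂)
    (hβ : ∀ c, β c ↔ S₂ y c = if (σ x).2 = true then 1 else 0)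
    {𝓑 : C₁ → C₂ → Set α}
    (hB : ∀ c₁ c₂, S₁ x c₁ = S₂ y c₂ → M.IsBase (𝓑 c₁ c₂))
    (hB' : ∀ B, M.IsBase B → ∃ c₁ c₂, S₁ x c₁ = S₂ y c₂ ∧ 𝓑 c₁ c₂ = B)
    (hv𝓑 : ∀ j e, v j e = (𝓑 j.1.1 j.1.2).indicator (fun _ => (1 : ℝ)) (e : α)) :
    GluedBases M k (fun c => (τ c).1) (σ x).1 β 𝓑 := by
  classical
  have hcol : ∀ c₁ c₂ c₁' c₂' (h : S₁ x c₁ = S₂ y c₂) (h' : S₁ x c₁' = S₂ y c₂'),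
      𝓑 c₁ c₂ = 𝓑 c₁' c₂' → ∀ i, S₁ i c₁ = S₁ i c₁' := by
    intro c₁ c₂ c₁' c₂' h h' he i
    have hveq : v ⟨(c₁, c₂), h⟩ = v ⟨(c₁', c₂'), h'⟩ := by
      ext e
      rw [hv𝓑, hv𝓑, he]
    by_cases hi : i = x
    · rw [hi]
      exact hS.row_eq hveq (Sum.inr (Sum.inr ()))
    · exact hS.row_eq hveq (Sum.inl ⟨i, hi⟩)
  simp only [← hbit] at hB hB' hcol
  refine ⟨fun c => (τ c).2, fun T hT => ⟨τ.symm ⟨T, hT⟩, by simp⟩, ?_, ?_, hB, hB', ?_, ?_, ?_⟩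
  · simp only [hβ]
    split
    · exact hy.2.2
    · exact hy.2.1
  · simp only [hβ]
    split
    · exact hy.2.1.imp fun c hc => by rw [hc]; exact zero_ne_one
    · exact hy.2.2.imp fun c hc => by rw [hc]; exact one_ne_zero
  · intro e he
    obtain ⟨r, hr⟩ := hnonneg ⟨e, he⟩
    have hmem : ∀ c₁ c₂ (h : S₁ x c₁ = S₂ y c₂), e ∈ 𝓑 c₁ c₂ ↔
        twoProduct S₁ x S₂ y r ⟨(c₁, c₂), h⟩ = 1 := by
      intro c₁ c₂ h
      rw [hr, hv𝓑]
      by_cases h' : e ∈ 𝓑 c₁ c₂ <;> simp [h']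
    rcases r with i | i | i
    · have hi : ∀ c₁ c₂, ((σ x).1 ∈ (τ c₁).1 ↔ β c₂) →
          (e ∈ 𝓑 c₁ c₂ ↔ ((σ i.1).1 ∈ (τ c₁).1 ↔ (σ i.1).2 = true)) := by
        intro c₁ c₂ hc
        rw [hmem c₁ c₂ ((hbit _ _).1 hc), ← literal_eq_one_iff, ← hτ]
        rfl
      -- A row of `S₁` over the common coordinate is a function of the bit, so it counts as
      -- depending on `c₂`.
      by_cases hq : (σ i.1).1 = (σ x).1
      · refine Or.inr ⟨fun c => β c ↔ (σ i.1).2 = true, fun c₁ c₂ hc => ?_⟩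
        rw [hi c₁ c₂ hc, hq, hc]
      · exact Or.inl ⟨_, _, hq, hi⟩
    · exact Or.inr ⟨fun c => S₂ i.1 c = 1, fun c₁ c₂ hc => hmem c₁ c₂ ((hbit _ _).1 hc)⟩
    · refine Or.inr ⟨fun c => S₂ y c = 1, fun c₁ c₂ hc => ?_⟩
      refine (hmem c₁ c₂ ((hbit _ _).1 hc)).trans ?_
      change S₁ x c₁ = 1 ↔ S₂ y c₂ = 1
      rw [(hbit _ _).1 hc]
  · intro c₁ c₂ c₁' c₂' hc hc' he
    have := hcol c₁ c₂ c₁' c₂' hc hc' he x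
    rwa [hτ, hτ, literal_eq_iff] at this
  · obtain ⟨i, hi⟩ := hσ.exists_row hd (σ x).1
    refine ⟨(σ i).1, hi, fun c₁ c₂ c₁' c₂' hc hc' he => ?_⟩
    have := hcol c₁ c₂ c₁' c₂' hc hc' he i
    rwa [hτ, hτ, literal_eq_iff] at this

end MatroidSlack

/-! ### Assembly: the common sign decides between `k` and `d - k` -/

open MatroidSlack in
theorem mainTheorem10 {α R C R₁ C₁ R₂ C₂ : Type*}
    [Finite R] [Finite C] [Finite R₁] [Finite C₁] [Finite R₂] [Finite C₂]
    -- a connected matroid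
    (M : Matroid α) (hfin : M.Finite) (hconn : MatroidSlack.IsConnected M)
    -- a 0/1 slack matrix of `B(M)` with a row for each inequality `x_e ≥ 0`
    (S : Matrix R C ℝ) (v : C → M.E → ℝ)
    (hS : MatroidSlack.IsSlackMatrixAt S (MatroidSlack.basePolytope M) v)
    (h01 : ∀ i j, S i j = 0 ∨ S i j = 1)
    (hnonneg : ∀ e : M.E, ∃ i, ∀ j, S i j = v j e)
    -- up to permuting rows and columns, `S` is the 2-product of `(S₁, x)` and `(S₂, y)`
    (S₁ : Matrix R₁ C₁ ℝ) (x : R₁) (S₂ : Matrix R₂ C₂ ℝ) (y : R₂)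
    (hx : MatroidSlack.IsSpecialRow S₁ x) (hy : MatroidSlack.IsSpecialRow S₂ y)
    (ρ : R ≃ MatroidSlack.TwoProductRow x y) (γ : C ≃ MatroidSlack.TwoProductCol S₁ x S₂ y)
    (hprod : S = (MatroidSlack.twoProduct S₁ x S₂ y).submatrix ρ γ)
    -- `S₁` or `S₁ + (1 - x)` is `S_{d,k}`
    (d k : ℕ) (hk : 1 ≤ k) (hkd : k < d) (σ : R₁ → Fin d × Bool)
    (hσ : MatroidSlack.EqHypersimplexSlack S₁ x d k σ) :
    ∃ k' : ℕ, (k' = k ∨ k' = d - k) ∧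
      -- `k' = k` if some non-negativity row `x_e ≥ 0` of `S` is a row of `S₁ - x` that
      -- is identified with a non-negativity row of `S_{d,k}`
      ((∃ (e : M.E) (i : {i : R₁ // i ≠ x}) (q : Fin d), σ i.1 = (q, true) ∧
          ∀ j, S (ρ.symm (Sum.inl i)) j = v j e) → k' = k) ∧
      -- the ground set of `M` is embedded in `Option α`, which has room for the new element `p`
      ∃ (M₁ M₂ : Matroid (Option α)) (p : Option α),
        MatroidSlack.IsUniform M₁ d k' ∧
        MatroidSlack.IsTwoSum (M.mapEmbedding Function.Embedding.some) M₁ M₂ p ∧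
        MatroidSlack.IsSlackMatrix (MatroidSlack.addComplement S₂ y)
          (MatroidSlack.basePolytope M₂) := by
  classical
  have hS' := hS.reindex ρ γ hprod
  have hent : ∀ i j, twoProduct S₁ x S₂ y i j = S (ρ.symm i) (γ.symm j) := fun i j => by
    rw [hprod]; simp
  have h01' : ∀ i j, twoProduct S₁ x S₂ y i j = 0 ∨ twoProduct S₁ x S₂ y i j = 1 := fun i j => by
    rw [hent]; exact h01 _ _
  have hnn : ∀ e : M.E, ∃ i, ∀ j, twoProduct S₁ x S₂ y i j = (v ∘ γ.symm) j e := by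
    intro e
    obtain ⟨i, hi⟩ := hnonneg e
    exact ⟨ρ i, fun j => by rw [hent, ρ.symm_apply_apply, hi]; rfl⟩
  have hv : ∀ j e, (v ∘ γ.symm) j e = 0 ∨ (v ∘ γ.symm) j e = 1 := by
    intro j e
    obtain ⟨i, hi⟩ := hnn e
    rw [← hi]
    exact h01' _ _
  obtain ⟨τ, hτ⟩ := hσ.exists_equiv
  obtain rfl | hd : d = 2 ∨ 3 ≤ d := by omega
  -- Here `k = d - k`, so there is no sign to determine.
  · obtain rfl : k = 1 := by omega
    exact ⟨1, Or.inl rfl, fun _ => rfl,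
      exists_isTwoSum_isSlackMatrix_two hS' h01' hv hx hy τ hτ⟩
  obtain ⟨𝓑, hB, hB', hv𝓑⟩ := exists_bases hS' hv
  -- The bit on the `S₂` side, corrected by the sign with which the special row reads its
  -- coordinate.
  let β : C₂ → Prop := fun c => S₂ y c = if (σ x).2 = true then 1 else 0
  have hbit : ∀ c₁ c₂, ((σ x).1 ∈ (τ c₁).1 ↔ β c₂) ↔ S₁ x c₁ = S₂ y c₂ := by
    intro c₁ c₂
    rw [hτ, literal_eq]
    change (_ ↔ S₂ y c₂ = _) ↔ _
    cases (σ x).2 <;> by_cases h : (σ x).1 ∈ (τ c₁).1 <;> rcases hy.1 c₂ with h' | h' <;>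
      simp [h, h']
  have G := EqHypersimplexSlack.gluedBases hy hS' hnn hd hσ τ hτ hbit (fun _ => Iff.rfl) hB hB' hv𝓑
  have hinj : Function.Injective fun c => (τ c).1 := fun c c' h => τ.injective (Subtype.ext h)
  obtain ⟨b, hb⟩ := G.exists_sign hconn hk hkd hd
  obtain ⟨q₁, hq₁, -⟩ := exists_third hd (σ x).1 (σ x).1
  obtain ⟨e₁, -, -⟩ := hb q₁ hq₁
  -- At the common coordinate there need be no element; `e₁` is only a default value there.
  have hb' : ∀ q, ∃ e, q ≠ (σ x).1 → e ∈ M.E ∧ ∀ c₁ c₂, ((σ x).1 ∈ (τ c₁).1 ↔ β c₂) →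
      (e ∈ 𝓑 c₁ c₂ ↔ (q ∈ (τ c₁).1 ↔ b = true)) := by
    intro q
    by_cases hq : q = (σ x).1
    · exact ⟨e₁, fun h => absurd hq h⟩
    · obtain ⟨e, he⟩ := hb q hq
      exact ⟨e, fun _ => he⟩
  choose el hel using hb'
  cases b with
  | true =>
    exact ⟨k, Or.inl rfl, fun _ => rfl, G.exists_isTwoSum_isSlackMatrix hconn hS' h01' hy hv𝓑 hk hkd
      hd hinj hbit (fun i => ⟨_, hτ i⟩) ⟨_, hτ x⟩ (fun q hq => (hel q hq).1)
      (fun q hq => by simpa using (hel q hq).2)⟩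
  | false =>
    have G' := G.compl hkd.le
    have hbit' : ∀ c₁ c₂, ((σ x).1 ∈ (τ c₁).1ᶜ ↔ ¬ β c₂) ↔ ((σ x).1 ∈ (τ c₁).1 ↔ β c₂) :=
      fun c₁ c₂ => by rw [Finset.mem_compl, not_iff_not]
    have hlit : ∀ i c, S₁ i c = literal ((σ i).1, !(σ i).2) (τ c).1ᶜ := by
      intro i c
      rw [hτ, literal_eq, literal_eq]
      cases (σ i).2 <;> simp
    have hel' : ∀ q, q ≠ (σ x).1 → ∀ c₁ c₂, ((σ x).1 ∈ (τ c₁).1ᶜ ↔ ¬ β c₂) →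
        (el q ∈ 𝓑 c₁ c₂ ↔ q ∈ (τ c₁).1ᶜ) := by
      intro q hq c₁ c₂ hc
      rw [(hel q hq).2 c₁ c₂ ((hbit' _ _).1 hc)]
      simp
    refine ⟨d - k, Or.inr rfl, ?_, G'.exists_isTwoSum_isSlackMatrix hconn hS' h01' hy hv𝓑
      (by omega) (by omega) hd (fun c c' h => hinj (compl_injective h))
      (fun c₁ c₂ => (hbit' c₁ c₂).trans (hbit c₁ c₂)) (fun i => ⟨_, hlit i⟩) ⟨_, hlit x⟩
      (fun q hq => (hel q hq).1) hel'⟩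
    -- After complementation, a nonnegativity row identified with `x_q ≥ 0` would be the complement
    -- of a coordinate, possibly the common one, which `not_complement` rules out.
    rintro ⟨e, i, q, hσi, hi⟩
    refine (G'.not_complement hconn (by omega) (by omega) hd (fun q hq => (hel q hq).1) hel'
      e.2 (q := q) ?_).elim
    intro c₁ c₂ hc
    have hc' := (hbit _ _).1 ((hbit' _ _).1 hc)
    have h1 := hv𝓑 ⟨(c₁, c₂), hc'⟩ e
    have h2 := hi (γ.symm ⟨(c₁, c₂), hc'⟩)
    rw [← hent] at h2
    change S₁ i.1 c₁ = (v ∘ γ.symm) ⟨(c₁, c₂), hc'⟩ e at h2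
    rw [h1, hτ, hσi] at h2
    have h3 := literal_eq_one_iff (q, true) (τ c₁).1
    rw [h2] at h3
    rw [Finset.mem_compl, not_not]
    by_cases h : (e : α) ∈ 𝓑 c₁ c₂
    · simpa [h] using h3
    · simpa [h] using h3
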